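/- For $n\ge 0$ let $\alpha_n$ be the number of permutations of $n$ letters that avoid the pattern $321$ and the four patterns $351624$, $356124$, $451623$, $456123$ (so $\alpha_0=1$). Then $$\alpha_{n+1}=4\alpha_n-4\alpha_{n-1}+3\alpha_{n-2}+\alpha_{n-3}-\alpha_{n-4}\qquad\text{for all } n\ge 4 .$$ Moreover, there are real numbers $R_1,R_2,R_3,c_1,c_2,c_3$ and complex numbers $R_4,c_4$ such that the roots (with multiplicity) of the characteristic polynomial $x^5-4x^4+4x^3-3x^2-x+1$ are $R_1,R_2,R_3,R_4,\overline{R_4}$, and for all $n\ge 0$ $$\alpha_n=c_1R_1^n+c_2R_2^n+c_3R_3^n+c_4R_4^n+\overline{c_4R_4^n},$$ where, rounded to 5 digits after the decimal point (real and imaginary parts separately), $$R_1\approx-0.49569,\quad R_2\approx0.51154,\quad R_3\approx3.03090,\quad R_4\approx0.47662-1.03635i,$$ $$c_1\approx-0.01275,\quad c_2\approx1.03824,\quad c_3\approx0.16548,\quad c_4\approx-0.09548+0.02511i.$$ Furthermore, the coefficients $c_iR_i$ of the equivalent expansion $\alpha_n=c_1R_1\cdot R_1^{n-1}+c_2R_2\cdot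 R_2^{n-1}+c_3R_3\cdot R_3^{n-1}+c_4R_4\cdot R_4^{n-1}+\overline{c_4R_4\cdot R_4^{n-1}}$ $(n\ge1)$ are $$c_1R_1\approx0.00632,\quad c_2R_2\approx0.53110,\quad c_3R_3\approx0.50154,\quad c_4R_4\approx-0.01948+0.11092i.$$ -/

import Mathlib

/-- The word `a_1 … a_n` contains the pattern `v_1 … v_k`: some subsequence of `a` of length `k`
has its entries in the same relative order as `v`. -/
def ContainsPattern {n k : ℕ} (a : Fin n → Fin n) (v : Fin k → ℕ) : Prop :=
  ∃ f : Fin k → Fin n, StrictMono f ∧ ∀ i j : Fin k, a (f i) < a (f j) ↔ v i < v j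

/-- The four patterns 351624, 356124, 451623, 456123, in one-line notation. -/
def sixPatterns : List (Fin 6 → ℕ) :=
  [![3, 5, 1, 6, 2, 4], ![3, 5, 6, 1, 2, 4], ![4, 5, 1, 6, 2, 3], ![4, 5, 6, 1, 2, 3]]

/-- The permutations of `n` letters avoiding 321 and the four patterns of `sixPatterns`. -/
def avoiders (n : ℕ) : Set (Equiv.Perm (Fin n)) :=
  {w | ¬ ContainsPattern w ![3, 2, 1] ∧ ∀ v ∈ sixPatterns, ¬ ContainsPattern w v}

/-- The number of such permutations of `n` letters. -/
noncomputable def avoiderCount (n : ℕ) : ℕ := (avoiders n).ncard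

/-- The characteristic polynomial of the recurrence. -/
noncomputable def charQuintic : Polynomial ℂ :=
  Polynomial.X ^ 5 - 4 * Polynomial.X ^ 4 + 4 * Polynomial.X ^ 3 - 3 * Polynomial.X ^ 2
    - Polynomial.X + 1

/-- The real number `x`, rounded to 5 digits after the decimal point, is the decimal `a`. -/
def RoundsTo (x a : ℝ) : Prop := |x - a| < 1 / 2 * (1 / 10) ^ 5

/-- Real and imaginary parts of `z` round to `a` and `b`. -/
def RoundsToComplex (z : ℂ) (a b : ℝ) : Prop := RoundsTo z.re a ∧ RoundsTo z.im b

/-!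
A permutation avoiding 321 is determined by the positions and the values of its excedances (`j` with
`j < w j`), because it increases on the excedances and on the remaining positions. It is therefore the
same thing as a word of `n` letters in `Bool × Bool`, the letter at `i` telling whether the position `i`
is an excedance and whether the value `i` is attained at one. The height of the word after `t` letters
is the number of positions before the cut `t` whose values lie after it
(`wordHeight_permWord`); a word comes from a permutation exactly when the height is positive whenever
a value is attained at an excedance, and ends at zero (`exists_perm_of_admissibleUpTo`,
`eq_of_permWord_eq`). In other words, these are Motzkin paths with two kinds of level steps above
the axis.

For such permutations, avoiding the four patterns of length six is a local condition on the word: the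
height stays at most two, and no two consecutive letters, the first one read at height two, differ in
both coordinates. A violation displays one of the patterns, since three crossings of a cut give 456123
(`hasHexagon_of_two_lt_card`), and the two letters together with the crossings of the cut in front
of them give a pattern as well (`hasHexagon_of_switch`). Conversely, an occurrence of a pattern can
be tightened until it sits at two adjacent positions with two adjacent values (`exists_tight_hexagon`,
`exists_switch`).

The admissible words are recognised by an automaton with six states. Its transfer matrix gives the
recurrence and the initial values 1, 1, 2, 5, 14.

For the closed form, the real roots are located by sign changes, and the other two are the roots of
the quadratic cofactor of the real ones (`quotient_relations`, `exists_root_system`). Vandermonde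
interpolation expresses the sequence through the powers of the five roots, and pairing the initial
values with the coefficients of `f / (x - r)` gives the coefficient of a root `r` as
`G r / f' r` with `G = x⁴ - 3 x³ + 2 x² - 2 x - 2` (`exists_coefficients`). This shows that the
coefficients are real, respectively conjugate, and approximates the real ones; the relations for
`n = 0` and `n = 1` then approximate the complex one (`abs_sub_le_of_relations`).
-/

/-! ### Words and their heights -/

/-- The height reached by the word `a` after `i` letters: a letter `(x, y)` goes up by one if `x`
holds and down by one if `y` holds. -/
def wordHeight (a : ℕ → Bool × Bool) : ℕ → ℤ
  | 0 => 0
  | i + 1 => wordHeight a i + (if (a i).1 then 1 else 0) - (if (a i).2 then 1 else 0)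

/-- The first `n` letters of `a` are admissible: a letter that closes an excedance is only read at
positive height, the height stays at most two, and no two consecutive letters, the first of which is
read at height two, differ in both coordinates. -/
def AdmissibleUpTo (a : ℕ → Bool × Bool) (n : ℕ) : Prop :=
  ∀ i < n, ((a i).2 = true → 1 ≤ wordHeight a i) ∧ wordHeight a (i + 1) ≤ 2 ∧
    ∀ m, i = m + 1 → wordHeight a m = 2 → ¬ ((a m).1 ≠ (a i).1 ∧ (a m).2 ≠ (a i).2)

/-- The first `n` letters of `a` as a list, the last letter first. -/
def prefixList (a : ℕ → Bool × Bool) : ℕ → List (Bool × Bool)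
  | 0 => []
  | n + 1 => a n :: prefixList a n

theorem length_prefixList (a : ℕ → Bool × Bool) (n : ℕ) : (prefixList a n).length = n := by
  induction n with
  | zero => rfl
  | succ n ih => simp [prefixList, ih]

theorem prefixList_eq_iff (a b : ℕ → Bool × Bool) (n : ℕ) :
    prefixList a n = prefixList b n ↔ ∀ i < n, a i = b i := by
  induction n with
  | zero => simp [prefixList]
  | succ n ih =>
    simp only [prefixList, List.cons.injEq, ih, Nat.forall_lt_succ_right]
    exact and_comm

theorem exists_prefixList_eq (l : List (Bool × Bool)) :
    ∃ a : ℕ → Bool × Bool, prefixList a l.length = l := by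
  induction l with
  | nil => exact ⟨fun _ => (false, false), rfl⟩
  | cons x l ih =>
    obtain ⟨a, ha⟩ := ih
    refine ⟨Function.update a l.length x, ?_⟩
    have : prefixList (Function.update a l.length x) l.length = prefixList a l.length := by
      rw [prefixList_eq_iff]
      intro i hi
      simp [hi.ne]
    simp [prefixList, this, ha]

/-! ### The automaton -/

/-- The states of the automaton recognising admissible words. A state records the current height and,
if the last letter was read at height two, that letter. -/
inductive WordState
  | zero | one | oneD | two | twoL | twoF
  deriving DecidableEq

namespace WordState

instance : Fintype WordState :=
  ⟨{zero, one, oneD, two, twoL, twoF}, by intro s; cases s <;> decide⟩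

/-- The current height. -/
def height : WordState → ℤ
  | zero => 0
  | one | oneD => 1
  | two | twoL | twoF => 2

/-- The last letter, if it was read at height two. -/
def last : WordState → Option (Bool × Bool)
  | oneD => some (false, true)
  | twoL => some (true, true)
  | twoF => some (false, false)
  | zero | one | two => none

/-- The transition function; `none` is the rejecting state. -/
def step : WordState → Bool × Bool → Option WordState
  | zero, (false, false) => some zero
  | zero, (true, false) => some one
  | zero, (_, true) => none
  | one, (false, true) => some zero
  | one, (true, false) => some two
  | one, (true, true) => some one
  | one, (false, false) => some one
  | oneD, (false, true) => some zero
  | oneD, (true, false) => none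
  | oneD, (true, true) => some one
  | oneD, (false, false) => some one
  | two, (false, true) => some oneD
  | two, (true, false) => none
  | two, (true, true) => some twoL
  | two, (false, false) => some twoF
  | twoL, (false, true) => some oneD
  | twoL, (true, true) => some twoL
  | twoL, (_, false) => none
  | twoF, (false, true) => some oneD
  | twoF, (false, false) => some twoF
  | twoF, (true, _) => none

theorem step_eq_some_iff (s t : WordState) (x : Bool × Bool) :
    s.step x = some t ↔
      ((x.2 = true → 1 ≤ s.height) ∧
        s.height + (if x.1 then 1 else 0) - (if x.2 then 1 else 0) ≤ 2 ∧
        ∀ y, s.last = some y → ¬ (y.1 ≠ x.1 ∧ y.2 ≠ x.2)) ∧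
      t.height = s.height + (if x.1 then 1 else 0) - (if x.2 then 1 else 0) ∧
      t.last = if s.height = 2 then some x else none := by
  revert s t x
  decide

theorem exists_step_eq_some (s : WordState) (x : Bool × Bool)
    (h : (x.2 = true → 1 ≤ s.height) ∧
        s.height + (if x.1 then 1 else 0) - (if x.2 then 1 else 0) ≤ 2 ∧
        ∀ y, s.last = some y → ¬ (y.1 ≠ x.1 ∧ y.2 ≠ x.2)) :
    ∃ t, s.step x = some t := by
  revert s x
  decide

end WordState

open WordState

/-- The state reached after reading a list, whose head is the letter read last. -/
def runWord : List (Bool × Bool) → Option WordState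
  | [] => some zero
  | x :: l => (runWord l).bind fun s => s.step x

/-- What the automaton remembers of a word it has not rejected. -/
theorem admissibleUpTo_of_runWord (a : ℕ → Bool × Bool) (n : ℕ) (s : WordState)
    (hs : runWord (prefixList a n) = some s) :
    AdmissibleUpTo a n ∧ s.height = wordHeight a n ∧
        ∀ y, s.last = some y ↔ ∃ m, n = m + 1 ∧ wordHeight a m = 2 ∧ y = a m := by
  induction n generalizing s with
  | zero =>
    obtain rfl : zero = s := by simpa [prefixList, runWord] using hs
    refine ⟨fun i hi => absurd hi (Nat.not_lt_zero i), rfl, fun y => ?_⟩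
    simp [WordState.last]
  | succ n ih =>
    simp only [prefixList, runWord, Option.bind_eq_some_iff] at hs
    obtain ⟨t, ht, hst⟩ := hs
    obtain ⟨had, hht, hlast⟩ := ih t ht
    rw [step_eq_some_iff] at hst
    obtain ⟨⟨h1, h2, h3⟩, h4, h5⟩ := hst
    refine ⟨?_, by rw [h4, hht, wordHeight], ?_⟩
    · intro i hi
      rcases Nat.lt_succ_iff_lt_or_eq.mp hi with hi | rfl
      · exact had i hi
      · refine ⟨by rwa [← hht], by rw [wordHeight, ← hht]; exact h2, ?_⟩
        intro m hm hm2
        exact h3 _ ((hlast _).mpr ⟨m, hm, hm2, rfl⟩)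
    · intro y
      rw [h5, hht]
      split_ifs with h
      · simp [h, eq_comm]
      · simp [h]

theorem exists_runWord_of_admissibleUpTo (a : ℕ → Bool × Bool) (n : ℕ)
    (h : AdmissibleUpTo a n) : ∃ s, runWord (prefixList a n) = some s := by
  induction n with
  | zero => exact ⟨zero, rfl⟩
  | succ n ih =>
    obtain ⟨t, ht⟩ := ih fun i hi => h i (hi.trans (Nat.lt_succ_self n))
    obtain ⟨-, hht, hlast⟩ := admissibleUpTo_of_runWord a n t ht
    obtain ⟨h1, h2, h3⟩ := h n (Nat.lt_succ_self n)
    obtain ⟨s, hs⟩ := t.exists_step_eq_some (a n)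
      ⟨by rwa [hht], by rw [hht]; exact h2, fun y hy => by
        obtain ⟨m, hm, hm2, rfl⟩ := (hlast y).mp hy
        exact h3 m hm hm2⟩
    exact ⟨s, by simp [prefixList, runWord, ht, hs]⟩

theorem runWord_eq_zero_iff (a : ℕ → Bool × Bool) (n : ℕ) :
    runWord (prefixList a n) = some zero ↔ AdmissibleUpTo a n ∧ wordHeight a n = 0 := by
  constructor
  · intro h
    obtain ⟨h1, h2, -⟩ := admissibleUpTo_of_runWord a n zero h
    exact ⟨h1, h2.symm⟩
  · rintro ⟨h1, h2⟩
    obtain ⟨s, hs⟩ := exists_runWord_of_admissibleUpTo a n h1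
    have h3 : s.height = 0 := by rw [(admissibleUpTo_of_runWord a n s hs).2.1, h2]
    obtain rfl : s = zero := by cases s <;> first | rfl | exact absurd h3 (by decide)
    exact hs

/-! ### Counting accepted words -/

/-- All words of length `n`. -/
def wordsOfLength : ℕ → Finset (List (Bool × Bool))
  | 0 => {[]}
  | n + 1 => ((Finset.univ : Finset (Bool × Bool)) ×ˢ wordsOfLength n).image fun p => p.1 :: p.2

theorem mem_wordsOfLength (l : List (Bool × Bool)) (n : ℕ) :
    l ∈ wordsOfLength n ↔ l.length = n := by
  induction n generalizing l with
  | zero => simp [wordsOfLength]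
  | succ n ih => cases l <;> simp [wordsOfLength, ih]

/-- The number of words of length `n` that lead to the state `s`. -/
def stateCount (n : ℕ) (s : WordState) : ℕ :=
  ((wordsOfLength n).filter fun l => runWord l = some s).card

theorem stateCount_succ (n : ℕ) (s : WordState) :
    stateCount (n + 1) s = ∑ l ∈ wordsOfLength n,
      ((Finset.univ : Finset (Bool × Bool)).filter
        fun x => (runWord l).bind (fun t => t.step x) = some s).card := by
  rw [stateCount, Finset.card_filter, wordsOfLength, Finset.sum_image, Finset.sum_product_right]
  · simp only [Finset.card_filter, runWord]
  · rintro ⟨x, l⟩ - ⟨y, m⟩ - h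
    simpa using h

/-- Row `s` of the transfer matrix: if state `s` is reached from state `t` by `c t` letters, then the
counts satisfy the corresponding linear recursion. -/
theorem stateCount_succ_eq_sum (s : WordState) (c : WordState → ℕ)
    (hc : ∀ t, ((Finset.univ : Finset (Bool × Bool)).filter fun x => t.step x = some s).card = c t)
    (n : ℕ) : stateCount (n + 1) s = ∑ t, c t * stateCount n t := by
  have key : ∀ o : Option WordState,
      ((Finset.univ : Finset (Bool × Bool)).filter
        fun x => o.bind (fun t => t.step x) = some s).card
        = ∑ t, c t * if o = some t then 1 else 0 := by
    rintro (_ | t)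
    · simp
    · simp [hc]
  rw [stateCount_succ]
  simp only [key]
  rw [Finset.sum_comm]
  simp only [← Finset.mul_sum, stateCount, Finset.card_filter]

theorem sum_wordState (f : WordState → ℕ) :
    ∑ t, f t = f zero + f one + f oneD + f two + f twoL + f twoF := by
  have : (Finset.univ : Finset WordState) = {zero, one, oneD, two, twoL, twoF} := rfl
  rw [this]
  simp [add_assoc]

theorem stateCount_transfer (n : ℕ) :
    stateCount (n + 1) zero = stateCount n zero + stateCount n one + stateCount n oneD ∧
    stateCount (n + 1) one = stateCount n zero + 2 * stateCount n one + 2 * stateCount n oneD ∧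
    stateCount (n + 1) oneD = stateCount n two + stateCount n twoL + stateCount n twoF ∧
    stateCount (n + 1) two = stateCount n one ∧
    stateCount (n + 1) twoL = stateCount n two + stateCount n twoL ∧
    stateCount (n + 1) twoF = stateCount n two + stateCount n twoF := by
  refine ⟨?_, ?_, ?_, ?_, ?_, ?_⟩
  · rw [stateCount_succ_eq_sum zero
      (fun | zero => 1 | one => 1 | oneD => 1 | two => 0 | twoL => 0 | twoF => 0) (by decide),
      sum_wordState]
    ring
  · rw [stateCount_succ_eq_sum one
      (fun | zero => 1 | one => 2 | oneD => 2 | two => 0 | twoL => 0 | twoF => 0) (by decide),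
      sum_wordState]
    ring
  · rw [stateCount_succ_eq_sum oneD
      (fun | zero => 0 | one => 0 | oneD => 0 | two => 1 | twoL => 1 | twoF => 1) (by decide),
      sum_wordState]
    ring
  · rw [stateCount_succ_eq_sum two
      (fun | zero => 0 | one => 1 | oneD => 0 | two => 0 | twoL => 0 | twoF => 0) (by decide),
      sum_wordState]
    ring
  · rw [stateCount_succ_eq_sum twoL
      (fun | zero => 0 | one => 0 | oneD => 0 | two => 1 | twoL => 1 | twoF => 0) (by decide),
      sum_wordState]
    ring
  · rw [stateCount_succ_eq_sum twoF
      (fun | zero => 0 | one => 0 | oneD => 0 | two => 1 | twoL => 0 | twoF => 1) (by decide),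
      sum_wordState]
    ring

theorem stateCount_zero_initial :
    stateCount 0 zero = 1 ∧ stateCount 1 zero = 1 ∧ stateCount 2 zero = 2 ∧
      stateCount 3 zero = 5 ∧ stateCount 4 zero = 14 := by
  have h : stateCount 0 zero = 1 ∧ stateCount 0 one = 0 ∧ stateCount 0 oneD = 0 ∧
      stateCount 0 two = 0 ∧ stateCount 0 twoL = 0 ∧ stateCount 0 twoF = 0 := by decide
  have h0 := stateCount_transfer 0
  have h1 := stateCount_transfer 1
  have h2 := stateCount_transfer 2
  have h3 := stateCount_transfer 3
  simp only [Nat.reduceAdd] at h0 h1 h2 h3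
  simp [h, h0, h1, h2, h3]

theorem stateCount_zero_recurrence (n : ℕ) :
    (stateCount (n + 5) zero : ℤ) = 4 * stateCount (n + 4) zero - 4 * stateCount (n + 3) zero
      + 3 * stateCount (n + 2) zero + stateCount (n + 1) zero - stateCount n zero := by
  have h0 := stateCount_transfer n
  have h1 := stateCount_transfer (n + 1)
  have h2 := stateCount_transfer (n + 2)
  have h3 := stateCount_transfer (n + 3)
  have h4 := stateCount_transfer (n + 4)
  simp only [add_assoc n, Nat.reduceAdd] at h1 h2 h3 h4
  simp only [h0, h1, h2, h3, h4]
  push_cast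
  ring

/-! ### Crossing numbers of a permutation -/

section Crossings

variable {n : ℕ}

/-- The positions before the cut `t` whose values lie after it. -/
def crossUp (w : Equiv.Perm (Fin n)) (t : ℕ) : Finset (Fin n) :=
  Finset.univ.filter fun j => j.val < t ∧ t ≤ (w j).val

/-- The positions after the cut `t` whose values lie before it. -/
def crossDown (w : Equiv.Perm (Fin n)) (t : ℕ) : Finset (Fin n) :=
  Finset.univ.filter fun j => t ≤ j.val ∧ (w j).val < t

theorem mem_crossUp {w : Equiv.Perm (Fin n)} {t : ℕ} {j : Fin n} :
    j ∈ crossUp w t ↔ j.val < t ∧ t ≤ (w j).val := by simp [crossUp]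

theorem mem_crossDown {w : Equiv.Perm (Fin n)} {t : ℕ} {j : Fin n} :
    j ∈ crossDown w t ↔ t ≤ j.val ∧ (w j).val < t := by simp [crossDown]

theorem card_crossUp_eq_card_crossDown (w : Equiv.Perm (Fin n)) (t : ℕ) :
    (crossUp w t).card = (crossDown w t).card := by
  have h1 : ∑ j : Fin n, (if (w j).val < t then 1 else 0)
      = ∑ j : Fin n, (if j.val < t then 1 else 0) :=
    Equiv.sum_comp w fun j => if j.val < t then 1 else 0
  have h2 : ∑ j : Fin n, ((if j.val < t ∧ t ≤ (w j).val then 1 else 0)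
        + (if (w j).val < t then 1 else 0))
      = ∑ j : Fin n, ((if t ≤ j.val ∧ (w j).val < t then 1 else 0)
        + (if j.val < t then 1 else 0)) := by
    refine Finset.sum_congr rfl fun j _ => ?_
    split_ifs <;> omega
  rw [Finset.sum_add_distrib, Finset.sum_add_distrib, h1] at h2
  simp only [crossUp, crossDown, Finset.card_filter]
  omega

/-- The word of a permutation: the letter at `i` says whether the position `i` is an excedance and
whether the value `i` is attained at an excedance. Letters beyond `n` are irrelevant. -/
noncomputable def permWord (w : Equiv.Perm (Fin n)) (i : ℕ) : Bool × Bool :=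
  if h : i < n then (decide ((⟨i, h⟩ : Fin n) < w ⟨i, h⟩), decide (w.symm ⟨i, h⟩ < ⟨i, h⟩))
  else (false, false)

theorem permWord_val (w : Equiv.Perm (Fin n)) (i : Fin n) :
    permWord w i = (decide (i < w i), decide (w.symm i < i)) := by
  simp [permWord]

theorem wordHeight_permWord (w : Equiv.Perm (Fin n)) (t : ℕ) (ht : t ≤ n) :
    wordHeight (permWord w) t = (crossUp w t).card := by
  induction t with
  | zero => simp [wordHeight, crossUp]
  | succ t ih =>
    have htn : t < n := ht
    set x : Fin n := ⟨t, htn⟩ with hx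
    have hxt : x.val = t := rfl
    have h2 : ∑ j : Fin n, ((if j.val < t ∧ t ≤ (w j).val then 1 else 0)
          + (if j = x then (if x < w x then 1 else 0) else 0))
        = ∑ j : Fin n, ((if j.val < t + 1 ∧ t + 1 ≤ (w j).val then 1 else 0)
          + (if j = w.symm x then (if w.symm x < x then 1 else 0) else 0)) := by
      refine Finset.sum_congr rfl fun j _ => ?_
      by_cases h1 : j = x
      · subst h1
        by_cases h3 : x = w.symm x
        · have h4 : w x = x := by
            conv_lhs => rw [h3]
            simp
          rw [← h3]
          simp [h4, hxt]
        · have h4 : (w x).val ≠ t := by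
            intro h
            exact h3 (by rw [Equiv.eq_symm_apply]; exact Fin.ext h)
          simp only [if_true, if_neg h3, Fin.lt_def, hxt]
          split_ifs <;> omega
      · have h5 : j.val ≠ t := fun h => h1 (Fin.ext h)
        by_cases h3 : j = w.symm x
        · have h4 : w j = x := by rw [h3]; simp
          rw [← h3]
          simp only [if_neg h1, if_true, h4, Fin.lt_def, hxt]
          split_ifs <;> omega
        · have h4 : (w j).val ≠ t := by
            intro h
            exact h3 (by rw [Equiv.eq_symm_apply]; exact Fin.ext h)
          simp only [if_neg h1, if_neg h3]
          split_ifs <;> omega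
    rw [Finset.sum_add_distrib, Finset.sum_add_distrib] at h2
    simp only [Finset.sum_ite_eq', Finset.mem_univ, if_true, ← Finset.card_filter] at h2
    have h3 : (crossUp w t).card + (if x < w x then 1 else 0)
        = (crossUp w (t + 1)).card + (if w.symm x < x then 1 else 0) := h2
    have h4 := permWord_val w x
    rw [hxt] at h4
    rw [wordHeight, ih htn.le, h4]
    simp only [decide_eq_true_eq]
    split_ifs at h3 ⊢ <;> omega

/-! ### Permutations avoiding 321 -/

/-- There is no decreasing subsequence of length three. -/
def AvoidsDecreasing (w : Equiv.Perm (Fin n)) : Prop :=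
  ∀ a b c, a < b → b < c → w b < w a → ¬ w c < w b

theorem not_containsPattern_321_iff (w : Equiv.Perm (Fin n)) :
    ¬ ContainsPattern w ![3, 2, 1] ↔ AvoidsDecreasing w := by
  constructor
  · intro h a b c hab hbc h1 h2
    refine h ⟨![a, b, c], ?_, ?_⟩
    · rw [Fin.strictMono_iff_lt_succ]
      intro i
      fin_cases i
      · exact hab
      · exact hbc
    · intro i j
      have h3 := h2.trans h1
      fin_cases i <;> fin_cases j <;> simp [h1, h2, h3, h1.le, h2.le, h3.le]
  · rintro h ⟨f, hf, hv⟩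
    exact h (f 0) (f 1) (f 2) (hf (by decide)) (hf (by decide)) ((hv 1 0).mpr (by decide))
      ((hv 2 1).mpr (by decide))

theorem avoidsDecreasing_of_strictMonoOn (w : Equiv.Perm (Fin n)) (p : Fin n → Prop)
    (h1 : ∀ a b, p a → p b → a < b → w a < w b)
    (h2 : ∀ a b, ¬ p a → ¬ p b → a < b → w a < w b) : AvoidsDecreasing w := by
  intro a b c hab hbc hba hcb
  by_cases ha : p a <;> by_cases hb : p b <;> by_cases hc : p c
  all_goals first
    | exact absurd (h1 _ _ ha hb hab) hba.asymm
    | exact absurd (h2 _ _ ha hb hab) hba.asymm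
    | exact absurd (h1 _ _ hb hc hbc) hcb.asymm
    | exact absurd (h2 _ _ hb hc hbc) hcb.asymm
    | exact absurd (h1 _ _ ha hc (hab.trans hbc)) (hcb.trans hba).asymm
    | exact absurd (h2 _ _ ha hc (hab.trans hbc)) (hcb.trans hba).asymm

namespace AvoidsDecreasing

variable {w : Equiv.Perm (Fin n)}

/-- The excedances increase: across the cut behind an excedance `b` some later position carries a
small value, and would complete a descent of excedances to a decreasing sequence of length three. -/
theorem exc_lt (hw : AvoidsDecreasing w) {a b : Fin n} (hb : b < w b)
    (hab : a < b) : w a < w b := by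
  by_contra h
  have hne : w a ≠ w b := fun h' => hab.ne (w.injective h')
  have h1 : b ∈ crossUp w (b.val + 1) := mem_crossUp.mpr ⟨by omega, hb⟩
  have h2 : 0 < (crossDown w (b.val + 1)).card := by
    rw [← card_crossUp_eq_card_crossDown]
    exact Finset.card_pos.mpr ⟨b, h1⟩
  obtain ⟨c, hc⟩ := Finset.card_pos.mp h2
  rw [mem_crossDown] at hc
  exact hw a b c hab (Fin.lt_def.mpr (by omega)) (lt_of_le_of_ne (not_lt.mp h) hne.symm)
    (lt_of_le_of_lt (Fin.le_def.mpr (by omega)) hb)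

theorem nonExc_lt (hw : AvoidsDecreasing w) {a b : Fin n} (ha : w a ≤ a)
    (hab : a < b) : w a < w b := by
  by_contra h
  have hne : w a ≠ w b := fun h' => hab.ne (w.injective h')
  have hlt : w b < w a := lt_of_le_of_ne (not_lt.mp h) hne.symm
  have h1 : b ∈ crossDown w a.val := mem_crossDown.mpr ⟨hab.le, lt_of_lt_of_le hlt ha⟩
  have h2 : 0 < (crossUp w a.val).card := by
    rw [card_crossUp_eq_card_crossDown]
    exact Finset.card_pos.mpr ⟨b, h1⟩
  obtain ⟨c, hc⟩ := Finset.card_pos.mp h2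
  rw [mem_crossUp] at hc
  have hca : c < a := hc.1
  have hle : w a ≤ w c := ha.trans hc.2
  exact hw c a b hca hab (lt_of_le_of_ne hle fun h' => hca.ne' (w.injective h')) hlt

theorem exc_of_inversion (hw : AvoidsDecreasing w) {a b : Fin n} (hab : a < b) (h : w b < w a) :
    a < w a := by
  by_contra h'
  exact h.asymm (hw.nonExc_lt (not_lt.mp h') hab)

theorem nonExc_of_inversion (hw : AvoidsDecreasing w) {a b : Fin n} (hab : a < b)
    (h : w b < w a) : w b ≤ b := by
  by_contra h'
  exact h.asymm (hw.exc_lt (not_le.mp h') hab)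

end AvoidsDecreasing

end Crossings

/-! ### Hexagons -/

section Hexagons

variable {n : ℕ}

/-- The common part of the four patterns of length six: the relative orders of `i₃`, `i₄` and of the
values at `i₁`, `i₆` are left open, and the four ways to fix them give the four patterns. -/
def HasHexagon (w : Equiv.Perm (Fin n)) : Prop :=
  ∃ i₁ i₂ i₃ i₄ i₅ i₆ : Fin n, (i₁ < i₂ ∧ i₂ < i₃ ∧ i₂ < i₄ ∧ i₃ < i₅ ∧ i₄ < i₅ ∧ i₅ < i₆) ∧
    w i₃ < w i₅ ∧ w i₅ < w i₁ ∧ w i₅ < w i₆ ∧ w i₁ < w i₂ ∧ w i₆ < w i₂ ∧ w i₂ < w i₄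

/-- An occurrence of a pattern with distinct entries: it suffices that smaller entries of the pattern
correspond to smaller values. -/
theorem containsPattern_of_lt {k : ℕ} (w : Equiv.Perm (Fin n)) (v : Fin k → ℕ)
    (hv : Function.Injective v) (f : Fin k → Fin n) (hf : StrictMono f)
    (h : ∀ i j, v i < v j → w (f i) < w (f j)) : ContainsPattern w v := by
  refine ⟨f, hf, fun i j => ⟨fun hij => ?_, h i j⟩⟩
  by_contra hv'
  rcases lt_or_eq_of_le (not_lt.mp hv') with h' | h'
  · exact hij.asymm (h j i h')
  · rw [hv h'] at hij
    exact lt_irrefl _ hij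

/-- Six positions whose values are listed in increasing order by the pattern. -/
theorem containsPattern_six (w : Equiv.Perm (Fin n)) (v : Fin 6 → ℕ) (σ : Fin 6 → Fin 6)
    (hσ : ∀ i, v (σ i) = i.val + 1) (hv : Function.Injective v) (f : Fin 6 → Fin n)
    (hf : ∀ i : Fin 5, f i.castSucc < f i.succ)
    (h : ∀ i : Fin 5, w (f (σ i.castSucc)) < w (f (σ i.succ))) : ContainsPattern w v := by
  have hσi : Function.Injective σ := by
    intro i j hij
    have := congrArg v hij
    rw [hσ, hσ] at this
    exact Fin.ext (by omega)
  have hσs : Function.Surjective σ := Finite.surjective_of_injective hσi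
  have hmono : StrictMono fun i => w (f (σ i)) := Fin.strictMono_iff_lt_succ.mpr h
  refine containsPattern_of_lt w v hv f (Fin.strictMono_iff_lt_succ.mpr hf) fun i j hij => ?_
  obtain ⟨i, rfl⟩ := hσs i
  obtain ⟨j, rfl⟩ := hσs j
  rw [hσ, hσ] at hij
  exact hmono (Fin.lt_def.mpr (by omega))

theorem hasHexagon_iff_exists_containsPattern (w : Equiv.Perm (Fin n)) :
    HasHexagon w ↔ ∃ v ∈ sixPatterns, ContainsPattern w v := by
  constructor
  · rintro ⟨i₁, i₂, i₃, i₄, i₅, i₆, ⟨h12, h23, h24, h35, h45, h56⟩, w35, w51, w56, w12, w62, w24⟩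
    have h34 : i₃ ≠ i₄ := by
      rintro rfl
      exact lt_irrefl _ (w35.trans (w51.trans (w12.trans w24)))
    have w16 : w i₁ ≠ w i₆ :=
      fun h => (h12.trans (h23.trans (h35.trans h56))).ne (w.injective h)
    rcases lt_or_gt_of_ne h34 with h34 | h34 <;> rcases lt_or_gt_of_ne w16 with w16 | w16
    · refine ⟨![3, 5, 1, 6, 2, 4], by simp [sixPatterns], containsPattern_six w _ ![2, 4, 0, 5, 1, 3]
        (by decide) (by decide) ![i₁, i₂, i₃, i₄, i₅, i₆] ?_ ?_⟩ <;>
      · intro i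
        fin_cases i <;> assumption
    · refine ⟨![4, 5, 1, 6, 2, 3], by simp [sixPatterns], containsPattern_six w _ ![2, 4, 5, 0, 1, 3]
        (by decide) (by decide) ![i₁, i₂, i₃, i₄, i₅, i₆] ?_ ?_⟩ <;>
      · intro i
        fin_cases i <;> assumption
    · refine ⟨![3, 5, 6, 1, 2, 4], by simp [sixPatterns], containsPattern_six w _ ![3, 4, 0, 5, 1, 2]
        (by decide) (by decide) ![i₁, i₂, i₄, i₃, i₅, i₆] ?_ ?_⟩ <;>
      · intro i
        fin_cases i <;> assumption
    · refine ⟨![4, 5, 6, 1, 2, 3], by simp [sixPatterns], containsPattern_six w _ ![3, 4, 5, 0, 1, 2]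
        (by decide) (by decide) ![i₁, i₂, i₄, i₃, i₅, i₆] ?_ ?_⟩ <;>
      · intro i
        fin_cases i <;> assumption
  · rintro ⟨v, hv, f, hf, hfv⟩
    simp only [sixPatterns, List.mem_cons, List.not_mem_nil, or_false] at hv
    rcases hv with rfl | rfl | rfl | rfl
    · refine ⟨f 0, f 1, f 2, f 3, f 4, f 5, ?_, ?_⟩
      · refine ⟨?_, ?_, ?_, ?_, ?_, ?_⟩ <;> exact hf (by decide)
      · refine ⟨?_, ?_, ?_, ?_, ?_, ?_⟩ <;> exact (hfv _ _).mpr (by decide)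
    · refine ⟨f 0, f 1, f 3, f 2, f 4, f 5, ?_, ?_⟩
      · refine ⟨?_, ?_, ?_, ?_, ?_, ?_⟩ <;> exact hf (by decide)
      · refine ⟨?_, ?_, ?_, ?_, ?_, ?_⟩ <;> exact (hfv _ _).mpr (by decide)
    · refine ⟨f 0, f 1, f 2, f 3, f 4, f 5, ?_, ?_⟩
      · refine ⟨?_, ?_, ?_, ?_, ?_, ?_⟩ <;> exact hf (by decide)
      · refine ⟨?_, ?_, ?_, ?_, ?_, ?_⟩ <;> exact (hfv _ _).mpr (by decide)
    · refine ⟨f 0, f 1, f 3, f 2, f 4, f 5, ?_, ?_⟩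
      · refine ⟨?_, ?_, ?_, ?_, ?_, ?_⟩ <;> exact hf (by decide)
      · refine ⟨?_, ?_, ?_, ?_, ?_, ?_⟩ <;> exact (hfv _ _).mpr (by decide)

theorem exists_three_lt_of_two_lt_card {s : Finset (Fin n)} (h : 2 < s.card) :
    ∃ a ∈ s, ∃ b ∈ s, ∃ c ∈ s, a < b ∧ b < c := by
  have e := s.orderEmbOfFin_mem rfl
  refine ⟨s.orderEmbOfFin rfl ⟨0, by omega⟩, e _, s.orderEmbOfFin rfl ⟨1, by omega⟩, e _,
    s.orderEmbOfFin rfl ⟨2, by omega⟩, e _, ?_, ?_⟩ <;>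
  · rw [OrderEmbedding.lt_iff_lt]
    exact Fin.lt_def.mpr (by simp)

theorem exists_two_lt_of_one_lt_card {s : Finset (Fin n)} (h : 1 < s.card) :
    ∃ a ∈ s, ∃ b ∈ s, a < b := by
  have e := s.orderEmbOfFin_mem rfl
  refine ⟨s.orderEmbOfFin rfl ⟨0, by omega⟩, e _, s.orderEmbOfFin rfl ⟨1, by omega⟩, e _, ?_⟩
  rw [OrderEmbedding.lt_iff_lt]
  exact Fin.lt_def.mpr (by simp)

theorem two_lt_card_of_three_lt {s : Finset (Fin n)} {a b c : Fin n} (ha : a ∈ s) (hb : b ∈ s)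
    (hc : c ∈ s) (hab : a < b) (hbc : b < c) : 2 < s.card :=
  Finset.two_lt_card.mpr ⟨a, ha, b, hb, c, hc, hab.ne, (hab.trans hbc).ne, hbc.ne⟩

namespace AvoidsDecreasing

variable {w : Equiv.Perm (Fin n)}

/-- Three positions crossing a cut upwards and three crossing it downwards form 456123. -/
theorem hasHexagon_of_two_lt_card (hw : AvoidsDecreasing w) {t : ℕ}
    (h : 2 < (crossUp w t).card) : HasHexagon w := by
  obtain ⟨a, ha, b, hb, c, hc, hab, hbc⟩ := exists_three_lt_of_two_lt_card h
  rw [card_crossUp_eq_card_crossDown] at h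
  obtain ⟨d, hd, e, he, f, hf, hde, hef⟩ := exists_three_lt_of_two_lt_card h
  rw [mem_crossUp] at ha hb hc
  rw [mem_crossDown] at hd he hf
  have h1 : w a < w b := hw.exc_lt (Fin.lt_def.mpr (by omega)) hab
  have h2 : w b < w c := hw.exc_lt (Fin.lt_def.mpr (by omega)) hbc
  have h3 : w d < w e := hw.nonExc_lt (Fin.le_def.mpr (by omega)) hde
  have h4 : w e < w f := hw.nonExc_lt (Fin.le_def.mpr (by omega)) hef
  exact ⟨a, b, d, c, e, f, ⟨hab, Fin.lt_def.mpr (by omega), hbc, hde, Fin.lt_def.mpr (by omega),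
    hef⟩, h3, Fin.lt_def.mpr (by omega), h4, h1, Fin.lt_def.mpr (by omega), h2⟩

/-- Two positions `i`, `i + 1`, exactly one an excedance, and the values `i`, `i + 1`, exactly one
attained at an excedance, form a hexagon together with the later of two positions crossing the cut
`i` upwards and the later of two crossing it downwards. Here `p`, `q` are the positions `i`, `i + 1` in some order, and `v`, `u` the positions of the
values `i`, `i + 1` in some order. -/
theorem hasHexagon_of_switch (hw : AvoidsDecreasing w) {i : ℕ} {p q v u : Fin n}
    (hcard : 2 ≤ (crossUp w i).card) (hp : p < w p) (hq : w q ≤ q) (hv : v < w v) (hu : w u ≤ u)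
    (hpq : p.val = i ∧ q.val = i + 1 ∨ p.val = i + 1 ∧ q.val = i)
    (hvu : (w v).val = i ∧ (w u).val = i + 1 ∨ (w v).val = i + 1 ∧ (w u).val = i) :
    HasHexagon w := by
  obtain ⟨a, ha, b, hb, hab⟩ := exists_two_lt_of_one_lt_card (show 1 < _ from hcard)
  rw [card_crossUp_eq_card_crossDown] at hcard
  obtain ⟨d, hd, e, he, hde⟩ := exists_two_lt_of_one_lt_card (show 1 < _ from hcard)
  rw [mem_crossUp] at ha hb
  rw [mem_crossDown] at hd he
  have hae : a < w a := Fin.lt_def.mpr (by omega)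
  have hbe : b < w b := Fin.lt_def.mpr (by omega)
  have hdn : w d ≤ d := Fin.le_def.mpr (by omega)
  have hen : w e ≤ e := Fin.le_def.mpr (by omega)
  have hwab := hw.exc_lt hbe hab
  have hwde := hw.nonExc_lt hdn hde
  have hbp : b < p := Fin.lt_def.mpr (by omega)
  have hwbp := hw.exc_lt hp hbp
  have hpd : p ≠ d := by
    rintro rfl
    exact absurd hp (not_lt.mpr hdn)
  have hpe : p ≠ e := by
    rintro rfl
    exact absurd hp (not_lt.mpr hen)
  have hqd : q ≤ d := by
    rw [Fin.le_def]
    have : p.val ≠ d.val := fun h => hpd (Fin.ext h)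
    omega
  have hqe : q < e := lt_of_le_of_lt hqd hde
  have hwqe := hw.nonExc_lt hq hqe
  have hpe' : p < e := by
    have : p.val ≠ e.val := fun h => hpe (Fin.ext h)
    rw [Fin.lt_def] at hqe ⊢
    omega
  have hau : u ≠ a := by
    rintro rfl
    exact absurd hae (not_lt.mpr hu)
  have hbu : u ≠ b := by
    rintro rfl
    exact absurd hbe (not_lt.mpr hu)
  have hwau : (w u).val ≠ (w a).val := fun h => hau (w.injective (Fin.ext h))
  have hwbu : (w u).val ≠ (w b).val := fun h => hbu (w.injective (Fin.ext h))
  have hvb : w v < w b := by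
    rw [Fin.lt_def] at hwab ⊢
    omega
  have hvb' : v < b := by
    by_contra h
    rcases lt_or_eq_of_le (not_lt.mp h) with h | h
    · exact hvb.asymm (hw.exc_lt hv h)
    · rw [h] at hvb
      exact lt_irrefl _ hvb
  have heu : e < u := by
    by_contra h
    have h1 : w u ≤ w e := by
      rcases lt_or_eq_of_le (not_lt.mp h) with h | h
      · exact (hw.nonExc_lt hu h).le
      · rw [h]
    rw [Fin.le_def] at h1
    omega
  refine ⟨v, b, q, p, e, u, ⟨hvb', Fin.lt_def.mpr (by omega), hbp, hqe, hpe', heu⟩, hwqe,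
    Fin.lt_def.mpr (by omega), Fin.lt_def.mpr (by omega), hvb, ?_, hwbp⟩
  rw [Fin.lt_def] at hwab ⊢
  omega

theorem admissibleUpTo_of_not_hasHexagon (hw : AvoidsDecreasing w) (h : ¬ HasHexagon w) :
    AdmissibleUpTo (permWord w) n := by
  intro i hi
  set x : Fin n := ⟨i, hi⟩ with hx
  have hxi : x.val = i := rfl
  have hpx := permWord_val w x
  rw [hxi] at hpx
  rw [wordHeight_permWord w i hi.le, wordHeight_permWord w (i + 1) hi, hpx]
  refine ⟨?_, ?_, ?_⟩
  · intro h1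
    have h1 : w.symm x < x := by simpa using h1
    have : w.symm x ∈ crossUp w i := mem_crossUp.mpr ⟨h1, by simp [hxi]⟩
    exact_mod_cast Finset.card_pos.mpr ⟨_, this⟩
  · by_contra h1
    exact h (hw.hasHexagon_of_two_lt_card (t := i + 1) (by omega))
  · rintro m rfl hm
    have hmn : m < n := by omega
    set y : Fin n := ⟨m, hmn⟩ with hy
    have hym : y.val = m := rfl
    have hpy := permWord_val w y
    rw [hym] at hpy
    rw [wordHeight_permWord w m hmn.le] at hm
    rw [hpy]
    rintro ⟨h1, h2⟩
    have hcard : 2 ≤ (crossUp w m).card := by omega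
    have hwx : (w (w.symm x)).val = m + 1 := by simp [hxi]
    have hwy : (w (w.symm y)).val = m := by simp [hym]
    have h1' : (y < w y) ≠ (x < w x) := by simpa using h1
    have h2' : (w.symm y < y) ≠ (w.symm x < x) := by simpa using h2
    have hvx : (w.symm x < x) ↔ w.symm x < w (w.symm x) := by simp
    have hvy : (w.symm y < y) ↔ w.symm y < w (w.symm y) := by simp
    rw [hvx, hvy] at h2'
    apply h
    have hP : ∃ p q : Fin n, p < w p ∧ w q ≤ q ∧
        (p.val = m ∧ q.val = m + 1 ∨ p.val = m + 1 ∧ q.val = m) := by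
      by_cases p1 : y < w y
      · exact ⟨y, x, p1, not_lt.mp fun p2 => h1' (propext (iff_of_true p1 p2)), Or.inl ⟨hym, hxi⟩⟩
      · exact ⟨x, y, by_contra fun p2 => h1' (propext (iff_of_false p1 p2)), not_lt.mp p1,
          Or.inr ⟨hxi, hym⟩⟩
    have hV : ∃ v u : Fin n, v < w v ∧ w u ≤ u ∧
        ((w v).val = m ∧ (w u).val = m + 1 ∨ (w v).val = m + 1 ∧ (w u).val = m) := by
      by_cases p1 : w.symm y < w (w.symm y)
      · exact ⟨w.symm y, w.symm x, p1, not_lt.mp fun p2 => h2' (propext (iff_of_true p1 p2)),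
          Or.inl ⟨hwy, hwx⟩⟩
      · exact ⟨w.symm x, w.symm y, by_contra fun p2 => h2' (propext (iff_of_false p1 p2)),
          not_lt.mp p1, Or.inr ⟨hwx, hwy⟩⟩
    obtain ⟨p, q, hp, hq, hpq⟩ := hP
    obtain ⟨v, u, hv, hu, hvu⟩ := hV
    exact hw.hasHexagon_of_switch hcard hp hq hv hu hpq hvu

end AvoidsDecreasing

end Hexagons

/-! ### Hexagons violate admissibility -/

section Converse

variable {n : ℕ}

theorem exists_last_lt (P : Fin n → Prop) {x y : Fin n} (hx : P x) (hxy : x < y) :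
    ∃ z, x ≤ z ∧ z < y ∧ P z ∧ ∀ j, z < j → j < y → ¬ P j := by
  classical
  obtain ⟨z, hz, hmax⟩ := Finset.exists_max_image (Finset.univ.filter fun j => P j ∧ j < y) id
    ⟨x, by simp [hx, hxy]⟩
  simp only [Finset.mem_filter, Finset.mem_univ, true_and, id] at hz hmax
  exact ⟨z, hmax x ⟨hx, hxy⟩, hz.2, hz.1, fun j h1 h2 h3 => h1.not_ge (hmax j ⟨h3, h2⟩)⟩

theorem exists_first_gt (P : Fin n → Prop) {x y : Fin n} (hy : P y) (hxy : x < y) :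
    ∃ z, z ≤ y ∧ x < z ∧ P z ∧ ∀ j, x < j → j < z → ¬ P j := by
  classical
  obtain ⟨z, hz, hmin⟩ := Finset.exists_min_image (Finset.univ.filter fun j => P j ∧ x < j) id
    ⟨y, by simp [hy, hxy]⟩
  simp only [Finset.mem_filter, Finset.mem_univ, true_and, id] at hz hmin
  exact ⟨z, hmin y ⟨hy, hxy⟩, hz.2, hz.1, fun j h1 h2 h3 => h2.not_ge (hmin j ⟨h3, h1⟩)⟩

namespace AvoidsDecreasing

variable {w : Equiv.Perm (Fin n)}

theorem val_exc_lt_iff (hw : AvoidsDecreasing w) {a b : Fin n} (ha : a < w a) (hb : b < w b) :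
    w a < w b ↔ a < b := by
  constructor
  · intro h
    by_contra h'
    rcases lt_or_eq_of_le (not_lt.mp h') with h' | rfl
    · exact h.asymm (hw.exc_lt ha h')
    · exact lt_irrefl _ h
  · exact hw.exc_lt hb

theorem val_nonExc_lt_iff (hw : AvoidsDecreasing w) {a b : Fin n} (ha : w a ≤ a) (hb : w b ≤ b) :
    w a < w b ↔ a < b := by
  constructor
  · intro h
    by_contra h'
    rcases lt_or_eq_of_le (not_lt.mp h') with h' | rfl
    · exact h.asymm (hw.nonExc_lt hb h')
    · exact lt_irrefl _ h
  · exact hw.nonExc_lt ha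

/-- A hexagon can be tightened: its excedances `a < b < p` may be taken consecutive among the
excedances, and its remaining positions `q < e < f` consecutive among the non-excedances. -/
theorem exists_tight_hexagon (hw : AvoidsDecreasing w) (h : HasHexagon w) :
    ∃ a b p q e f : Fin n, (a < w a ∧ b < w b ∧ p < w p) ∧ (w q ≤ q ∧ w e ≤ e ∧ w f ≤ f) ∧
      (a < b ∧ b < p ∧ q < e ∧ e < f) ∧ (b < q ∧ p < e ∧ w e < w a ∧ w f < w b) ∧
      (∀ j, a < j → j < b → ¬ j < w j) ∧ (∀ j, b < j → j < p → ¬ j < w j) ∧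
      (∀ j, q < j → j < e → ¬ w j ≤ j) ∧ ∀ j, e < j → j < f → ¬ w j ≤ j := by
  obtain ⟨i₁, i₂, i₃, i₄, i₅, i₆, ⟨h12, h23, h24, h35, h45, h56⟩, w35, w51, w56, w12, w62, w24⟩ := h
  have e1 : i₁ < w i₁ := hw.exc_of_inversion (h12.trans (h23.trans h35)) w51
  have e2 : i₂ < w i₂ := hw.exc_of_inversion (h23.trans (h35.trans h56)) w62
  have e4 : i₄ < w i₄ := hw.exc_of_inversion h45 (w51.trans (w12.trans w24))
  have e3 : w i₃ ≤ i₃ := hw.nonExc_of_inversion h23 (w35.trans (w51.trans w12))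
  have e5 : w i₅ ≤ i₅ := hw.nonExc_of_inversion h45 (w51.trans (w12.trans w24))
  have e6 : w i₆ ≤ i₆ := hw.nonExc_of_inversion (h23.trans (h35.trans h56)) w62
  obtain ⟨a, ha1, ha2, ha3, ha4⟩ := exists_last_lt (fun j => j < w j) e1 h12
  obtain ⟨p, hp1, hp2, hp3, hp4⟩ := exists_first_gt (fun j => j < w j) e4 h24
  obtain ⟨q, hq1, hq2, hq3, hq4⟩ := exists_last_lt (fun j => w j ≤ j) e3 h35
  obtain ⟨f, hf1, hf2, hf3, hf4⟩ := exists_first_gt (fun j => w j ≤ j) e6 h56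
  have wa : w i₁ ≤ w a := not_lt.mp fun h => ha1.not_gt ((hw.val_exc_lt_iff ha3 e1).mp h)
  have wf : w f ≤ w i₆ := not_lt.mp fun h => hf1.not_gt ((hw.val_nonExc_lt_iff e6 hf3).mp h)
  exact ⟨a, i₂, p, q, i₅, f, ⟨ha3, e2, hp3⟩, ⟨hq3, e5, hf3⟩, ⟨ha2, hp2, hq2, hf2⟩,
    ⟨h23.trans_le hq1, hp1.trans_lt h45, w51.trans_le wa, wf.trans_lt w62⟩, ha4, hp4, hq4, hf4⟩

/-- When at most two positions cross any cut, a hexagon sits at two consecutive positions `m`,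
`m + 1`, an excedance `p` and a non-excedance `q`, for which the
values `m`, `m + 1` are attained at an excedance `a` and a non-excedance `f`. -/
theorem exists_switch (hw : AvoidsDecreasing w) (hcard : ∀ t, (crossUp w t).card ≤ 2)
    (h : HasHexagon w) :
    ∃ (m : ℕ) (p q a f : Fin n), 2 ≤ (crossUp w m).card ∧ p < w p ∧ w q ≤ q ∧ a < w a ∧ w f ≤ f ∧
      (p.val = m ∧ q.val = m + 1 ∨ p.val = m + 1 ∧ q.val = m) ∧
      ((w a).val = m ∧ (w f).val = m + 1 ∨ (w a).val = m + 1 ∧ (w f).val = m) := by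
  obtain ⟨a, b, p, q, e, f, ⟨ea, eb, ep⟩, ⟨eq, ee, ef⟩, ⟨hab, hbp, hqe, hef⟩,
    ⟨hbq, hpe, wea, wfb⟩, c1, c2, c3, c4⟩ := hw.exists_tight_hexagon h
  -- No three positions cross a cut upwards, and hence no three cross it downwards.
  have up : ∀ (t : ℕ) (x y z : Fin n), x < y → y < z → z.val < t → t ≤ (w x).val →
      t ≤ (w y).val → t ≤ (w z).val → False := by
    intro t x y z hxy hyz hz h1 h2 h3
    rw [Fin.lt_def] at hxy hyz
    exact absurd (two_lt_card_of_three_lt (mem_crossUp.mpr ⟨by omega, h1⟩)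
      (mem_crossUp.mpr ⟨by omega, h2⟩) (mem_crossUp.mpr ⟨hz, h3⟩) hxy hyz) (hcard t).not_gt
  have down : ∀ (t : ℕ) (x y z : Fin n), x < y → y < z → t ≤ x.val → (w x).val < t →
      (w y).val < t → (w z).val < t → False := by
    intro t x y z hxy hyz hz h1 h2 h3
    rw [Fin.lt_def] at hxy hyz
    have := two_lt_card_of_three_lt (mem_crossDown.mpr ⟨hz, h1⟩)
      (mem_crossDown.mpr ⟨by omega, h2⟩) (mem_crossDown.mpr ⟨by omega, h3⟩) hxy hyz
    rw [← card_crossUp_eq_card_crossDown] at this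
    exact absurd this (hcard t).not_gt
  have wab := hw.exc_lt eb hab
  have wbp := hw.exc_lt ep hbp
  have wqe := hw.nonExc_lt eq hqe
  have wef := hw.nonExc_lt ee hef
  have qf : q.val ≤ (w f).val := by
    by_contra h'
    exact down q q e f hqe hef le_rfl (by omega) (by omega) (by omega)
  have ap : (w a).val ≤ p.val := by
    by_contra h'
    exact up (p + 1) a b p hab hbp (by omega) (by omega) (by omega) (by omega)
  have hpq : p ≠ q := by
    rintro rfl
    exact absurd ep (not_lt.mpr eq)
  have haf : w a ≠ w f := fun h' => by
    have h'' := w.injective h'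
    omega
  -- The positions `p` and `q` are adjacent.
  have adj : q.val = p.val + 1 ∨ p.val = q.val + 1 := by
    rcases lt_or_gt_of_ne hpq with hlt | hlt
    · left
      by_contra h'
      obtain ⟨j, hj⟩ : ∃ j : Fin n, j.val = p.val + 1 := ⟨⟨p.val + 1, by omega⟩, rfl⟩
      by_cases ej : j < w j
      · have := hw.exc_lt ej (show p < j by omega)
        exact up q b p j hbp (by omega) (by omega) (by omega) (by omega) (by omega)
      · have := hw.nonExc_lt (not_lt.mp ej) (show j < q by omega)
        exact down (p + 1) j q e (by omega) hqe (by omega) (by omega) (by omega) (by omega)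
    · right
      by_contra h'
      obtain ⟨j, hj⟩ : ∃ j : Fin n, j.val = q.val + 1 := ⟨⟨q.val + 1, by omega⟩, rfl⟩
      by_cases ej : j < w j
      · exact c2 j (by omega) (by omega) ej
      · exact c3 j (by omega) (by omega) (not_lt.mp ej)
  -- The values at `a` and `f` are adjacent.
  have vadj : (w f).val = (w a).val + 1 ∨ (w a).val = (w f).val + 1 := by
    rcases lt_or_gt_of_ne haf with hlt | hlt
    · left
      by_contra h'
      obtain ⟨j, hj⟩ : ∃ j : Fin n, (w j).val = (w a).val + 1 :=
        ⟨w.symm ⟨(w a).val + 1, by omega⟩, by simp⟩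
      by_cases ej : j < w j
      · exact c1 j ((hw.val_exc_lt_iff ea ej).mp (by omega))
          ((hw.val_exc_lt_iff ej eb).mp (by omega)) ej
      · have ej := not_lt.mp ej
        exact c4 j ((hw.val_nonExc_lt_iff ee ej).mp (by omega))
          ((hw.val_nonExc_lt_iff ej ef).mp (by omega)) ej
    · right
      by_contra h'
      obtain ⟨j, hj⟩ : ∃ j : Fin n, (w j).val = (w f).val + 1 :=
        ⟨w.symm ⟨(w f).val + 1, by omega⟩, by simp⟩
      by_cases ej : j < w j
      · have hja : j < a := (hw.val_exc_lt_iff ej ea).mp (by omega)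
        exact up (w j) j a b hja hab (by omega) (by omega) (by omega) (by omega)
      · have hfj : f < j := (hw.val_nonExc_lt_iff ef (not_lt.mp ej)).mp (by omega)
        exact down (w j + 1) e f j hef hfj (by omega) (by omega) (by omega) (by omega)
  rcases adj with adj | adj
  · refine ⟨p, p, q, a, f, ?_, ep, eq, ea, ef, Or.inl ⟨rfl, adj⟩, by omega⟩
    exact Finset.one_lt_card.mpr ⟨a, mem_crossUp.mpr (by omega), b, mem_crossUp.mpr (by omega),
      hab.ne⟩
  · have low : q.val ≤ (w a).val := by
      by_contra h'
      -- The cut `q` is crossed downwards by `q` and `e`, but upwards by `b` only.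
      have h1 : 1 < (crossDown w q).card :=
        Finset.one_lt_card.mpr ⟨q, mem_crossDown.mpr (by omega), e, mem_crossDown.mpr (by omega),
          hqe.ne⟩
      rw [← card_crossUp_eq_card_crossDown] at h1
      obtain ⟨j, hj, hjb⟩ := Finset.exists_mem_ne h1 b
      rw [mem_crossUp] at hj
      have ej : j < w j := by omega
      have haj : a < j := (hw.val_exc_lt_iff ea ej).mp (by omega)
      rcases lt_or_gt_of_ne hjb with hlt | hlt
      · exact c1 j haj hlt ej
      · exact c2 j hlt (by omega) ej
    have high : (w f).val ≤ q.val + 1 := by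
      by_contra h'
      -- The cut `q + 2` is crossed upwards by `b` and `p`, but downwards by `e` only.
      have h1 : 1 < (crossUp w (q + 2)).card :=
        Finset.one_lt_card.mpr ⟨b, mem_crossUp.mpr (by omega), p, mem_crossUp.mpr (by omega),
          hbp.ne⟩
      rw [card_crossUp_eq_card_crossDown] at h1
      obtain ⟨j, hj, hje⟩ := Finset.exists_mem_ne h1 e
      rw [mem_crossDown] at hj
      have ej : w j ≤ j := by omega
      have hjf : j < f := (hw.val_nonExc_lt_iff ej ef).mp (by omega)
      rcases lt_or_gt_of_ne hje with hlt | hlt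
      · exact c3 j (by omega) hlt ej
      · exact c4 j hlt hjf ej
    refine ⟨q, p, q, a, f, ?_, ep, eq, ea, ef, Or.inr ⟨adj, rfl⟩, by omega⟩
    exact Finset.one_lt_card.mpr ⟨a, mem_crossUp.mpr (by omega), b, mem_crossUp.mpr (by omega),
      hab.ne⟩

theorem not_hasHexagon_of_admissibleUpTo (hw : AvoidsDecreasing w)
    (had : AdmissibleUpTo (permWord w) n) : ¬ HasHexagon w := by
  intro h
  have hcard : ∀ t, (crossUp w t).card ≤ 2 := by
    intro t
    rcases Nat.lt_or_ge n t with ht | ht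
    · rw [Finset.card_eq_zero.mpr]
      · exact Nat.zero_le _
      · refine Finset.eq_empty_of_forall_notMem fun j hj => ?_
        rw [mem_crossUp] at hj
        omega
    · cases t with
      | zero => simp [crossUp]
      | succ t =>
        have := (had t ht).2.1
        rw [wordHeight_permWord w _ ht] at this
        exact_mod_cast this
  obtain ⟨m, p, q, a, f, hm, hp, hq, ha, hf, hpq, haf⟩ := hw.exists_switch hcard h
  have hlt : m + 1 < n := by omega
  refine (had (m + 1) hlt).2.2 m rfl ?_ ?_
  · rw [wordHeight_permWord w m (by omega)]
    exact_mod_cast le_antisymm (hcard m) hm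
  · have lp := permWord_val w p
    have lq := permWord_val w q
    have la := permWord_val w (w a)
    have lf := permWord_val w (w f)
    simp only [Equiv.symm_apply_apply] at la lf
    have e1 : (permWord w p).1 = true := by simp [lp, hp]
    have e2 : (permWord w q).1 = false := by simp [lq, hq]
    have e3 : (permWord w (w a)).2 = true := by simp [la, ha]
    have e4 : (permWord w (w f)).2 = false := by simp [lf, hf]
    constructor
    · rcases hpq with ⟨h1, h2⟩ | ⟨h1, h2⟩ <;> rw [h1] at e1 <;> rw [h2] at e2 <;> simp [e1, e2]
    · rcases haf with ⟨h1, h2⟩ | ⟨h1, h2⟩ <;> rw [h1] at e3 <;> rw [h2] at e4 <;> simp [e3, e4]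

end AvoidsDecreasing

theorem mem_avoiders_iff (w : Equiv.Perm (Fin n)) :
    w ∈ avoiders n ↔ AvoidsDecreasing w ∧ AdmissibleUpTo (permWord w) n := by
  have h : (∀ v ∈ sixPatterns, ¬ ContainsPattern w v) ↔ ¬ HasHexagon w := by
    rw [hasHexagon_iff_exists_containsPattern]
    push Not
    rfl
  rw [avoiders, Set.mem_ofPred_eq, not_containsPattern_321_iff, h]
  exact and_congr_right fun hw =>
    ⟨hw.admissibleUpTo_of_not_hasHexagon, hw.not_hasHexagon_of_admissibleUpTo⟩

end Converse

/-! ### Permutations and words -/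

section Bijection

variable {n : ℕ}

theorem not_apply_lt_of_permWord_eq {w w' : Equiv.Perm (Fin n)} (hw' : AvoidsDecreasing w')
    (h : ∀ i : Fin n, permWord w i = permWord w' i) {j : Fin n}
    (hj : ∀ i < j, w i = w' i) : ¬ w j < w' j := by
  intro hlt
  have h1 : ∀ i : Fin n, i < w i ↔ i < w' i := fun i => by
    have := congrArg Prod.fst (h i)
    simpa [permWord_val] using this
  -- The position to which `w'` assigns the value `w j`.
  set k := w'.symm (w j) with hk
  have hwk : w' k = w j := by simp [hk]
  have h2 : j < w j ↔ k < w' k := by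
    have := congrArg Prod.snd (h (w j))
    rw [hwk]
    simpa [permWord_val] using this
  have hkj : k < j := by
    by_cases ej : j < w j
    · exact (hw'.val_exc_lt_iff (h2.mp ej) ((h1 j).mp ej)).mp (hwk ▸ hlt)
    · exact (hw'.val_nonExc_lt_iff (not_lt.mp (mt h2.mpr ej))
        (not_lt.mp (mt (h1 j).mpr ej))).mp (hwk ▸ hlt)
  exact hkj.ne (w.injective ((hj k hkj).trans hwk))

theorem eq_of_permWord_eq {w w' : Equiv.Perm (Fin n)} (hw : AvoidsDecreasing w)
    (hw' : AvoidsDecreasing w') (h : ∀ i : Fin n, permWord w i = permWord w' i) : w = w' := by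
  refine Equiv.ext fun j => ?_
  induction j using WellFoundedLT.induction with
  | _ j ih =>
    exact le_antisymm
      (not_lt.mp (not_apply_lt_of_permWord_eq hw (fun i => (h i).symm) fun i hi => (ih i hi).symm))
      (not_lt.mp (not_apply_lt_of_permWord_eq hw' h ih))

/-- Sets of positions and values of the same size are matched by a permutation that increases on the
positions and on their complement. -/
theorem exists_perm_strictMonoOn (P V : Finset (Fin n)) (h : P.card = V.card) :
    ∃ w : Equiv.Perm (Fin n), (∀ j, w j ∈ V ↔ j ∈ P) ∧
      (∀ a b, a ∈ P → b ∈ P → a < b → w a < w b) ∧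
      ∀ a b, a ∉ P → b ∉ P → a < b → w a < w b := by
  classical
  have hc : Pᶜ.card = Vᶜ.card := by rw [Finset.card_compl, Finset.card_compl, h]
  let e : P ≃o V := (P.orderIsoOfFin rfl).symm.trans (V.orderIsoOfFin h.symm)
  let e' : (Pᶜ : Finset (Fin n)) ≃o (Vᶜ : Finset (Fin n)) :=
    (Pᶜ.orderIsoOfFin rfl).symm.trans (Vᶜ.orderIsoOfFin hc.symm)
  let f : Fin n → Fin n := fun j =>
    if hj : j ∈ P then e ⟨j, hj⟩ else e' ⟨j, Finset.mem_compl.mpr hj⟩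
  have f1 : ∀ j (hj : j ∈ P), f j = e ⟨j, hj⟩ := fun j hj => dif_pos hj
  have f2 : ∀ j (hj : j ∉ P), f j = e' ⟨j, Finset.mem_compl.mpr hj⟩ := fun j hj => dif_neg hj
  have hV : ∀ j, f j ∈ V ↔ j ∈ P := by
    intro j
    by_cases hj : j ∈ P
    · rw [f1 j hj]
      exact iff_of_true (e ⟨j, hj⟩).2 hj
    · rw [f2 j hj]
      exact iff_of_false (Finset.mem_compl.mp (e' ⟨j, _⟩).2) hj
  have m1 : ∀ a b, a ∈ P → b ∈ P → a < b → f a < f b := by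
    intro a b ha hb hab
    rw [f1 a ha, f1 b hb]
    exact e.strictMono hab
  have m2 : ∀ a b, a ∉ P → b ∉ P → a < b → f a < f b := by
    intro a b ha hb hab
    rw [f2 a ha, f2 b hb]
    exact e'.strictMono hab
  have hf : Function.Injective f := by
    intro a b hab
    by_contra hne
    have hP : a ∈ P ↔ b ∈ P := by rw [← hV a, ← hV b, hab]
    by_cases ha : a ∈ P
    · rcases lt_or_gt_of_ne hne with hlt | hlt
      · exact (m1 a b ha (hP.mp ha) hlt).ne hab
      · exact (m1 b a (hP.mp ha) ha hlt).ne' hab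
    · have hb := mt hP.mpr ha
      rcases lt_or_gt_of_ne hne with hlt | hlt
      · exact (m2 a b ha hb hlt).ne hab
      · exact (m2 b a hb ha hlt).ne' hab
  exact ⟨Equiv.ofBijective f (Finite.injective_iff_bijective.mp hf), hV, m1, m2⟩

theorem card_filter_lt_fin (p : ℕ → Prop) [DecidablePred p] {t : ℕ} (ht : t ≤ n) :
    (Finset.univ.filter fun j : Fin n => p j ∧ j.val < t).card = Nat.count p t := by
  rw [Nat.count_eq_card_filter_range, ← Finset.card_map Fin.valEmbedding]
  congr 1
  ext x
  simp only [Finset.mem_map, Finset.mem_filter, Finset.mem_univ, true_and, Fin.valEmbedding_apply,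
    Finset.mem_range]
  constructor
  · rintro ⟨j, ⟨h1, h2⟩, rfl⟩
    exact ⟨h2, h1⟩
  · rintro ⟨h1, h2⟩
    exact ⟨⟨x, by omega⟩, ⟨h2, h1⟩, rfl⟩

theorem wordHeight_eq_count_sub_count (a : ℕ → Bool × Bool) (t : ℕ) :
    wordHeight a t = (Nat.count (fun i => (a i).1 = true) t : ℤ)
      - Nat.count (fun i => (a i).2 = true) t := by
  induction t with
  | zero => simp [wordHeight]
  | succ t ih =>
    rw [wordHeight, ih, Nat.count_succ, Nat.count_succ]
    push_cast
    ring

theorem AdmissibleUpTo.wordHeight_nonneg {a : ℕ → Bool × Bool} (h : AdmissibleUpTo a n) {t : ℕ}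
    (ht : t ≤ n) : 0 ≤ wordHeight a t := by
  induction t with
  | zero => simp [wordHeight]
  | succ t ih =>
    have h1 := (h t ht).1
    have h2 := ih (by omega)
    rw [wordHeight]
    split_ifs with h3 h4 h4 <;> first | omega | (have := h1 h4; omega)

theorem count_add_count_not (p : ℕ → Prop) [DecidablePred p] (t : ℕ) :
    Nat.count p t + Nat.count (fun i => ¬ p i) t = t := by
  induction t with
  | zero => simp
  | succ t ih =>
    rw [Nat.count_succ, Nat.count_succ]
    split_ifs <;> first | contradiction | omega

/-- Matching an increasing set of positions with an increasing set of values keeps the number of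
earlier elements. -/
theorem count_eq_count_of_monotone {w : Equiv.Perm (Fin n)} (p q : ℕ → Prop) [DecidablePred p]
    [DecidablePred q] (hpq : ∀ j : Fin n, q (w j) ↔ p j)
    (hmono : ∀ a b : Fin n, p a → p b → a < b → w a < w b) {j : Fin n} (hj : p j) :
    Nat.count p j = Nat.count q (w j) := by
  rw [← card_filter_lt_fin p j.2.le, ← card_filter_lt_fin q (w j).2.le,
    ← Finset.card_map w.toEmbedding]
  congr 1
  ext y
  obtain ⟨x, rfl⟩ := w.surjective y
  simp only [Finset.mem_map_equiv, Equiv.symm_apply_apply, Finset.mem_filter, Finset.mem_univ,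
    true_and, hpq]
  refine and_congr_right fun hx => ⟨fun h => hmono x j hx hj h, fun h => ?_⟩
  by_contra h'
  rcases lt_or_eq_of_le (not_lt.mp h') with h' | h'
  · exact absurd (hmono j x hj hx (Fin.lt_def.mpr h')) (not_lt.mpr h.le)
  · rw [Fin.ext h'] at h
    exact lt_irrefl _ h

/-- Every admissible word that returns to height zero is the word of a permutation avoiding 321:
match positions and values of excedances in increasing order, and likewise the remaining ones.
The heights being non-negative makes the first matching move strictly up and the second one weakly
down. -/
theorem exists_perm_of_admissibleUpTo (a : ℕ → Bool × Bool) (had : AdmissibleUpTo a n)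
    (h0 : wordHeight a n = 0) :
    ∃ w : Equiv.Perm (Fin n), AvoidsDecreasing w ∧ ∀ i < n, permWord w i = a i := by
  let p : ℕ → Prop := fun i => (a i).1 = true
  let q : ℕ → Prop := fun i => (a i).2 = true
  have hheight := wordHeight_eq_count_sub_count a
  have hall : ∀ r : ℕ → Prop, ∀ [DecidablePred r],
      (Finset.univ.filter fun j : Fin n => r j).card = Nat.count r n := by
    intro r _
    rw [← card_filter_lt_fin r le_rfl]
    congr 1
    ext j
    simp
  obtain ⟨w, hV, m1, m2⟩ := exists_perm_strictMonoOn (Finset.univ.filter fun j : Fin n => p j)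
    (Finset.univ.filter fun j : Fin n => q j) (by
      rw [hall p, hall q]
      have := hheight n
      rw [h0] at this
      change (0 : ℤ) = Nat.count p n - Nat.count q n at this
      omega)
  simp only [Finset.mem_filter, Finset.mem_univ, true_and] at hV m1 m2
  have up : ∀ j : Fin n, p j → j < w j := by
    intro j hj
    have hc := count_eq_count_of_monotone p q hV m1 hj
    by_contra h
    have h1 := (had (w j) (w j).2).1 ((hV j).mpr hj)
    rw [hheight] at h1
    change (1 : ℤ) ≤ Nat.count p (w j) - Nat.count q (w j) at h1
    have h2 : Nat.count p (w j) ≤ Nat.count p j := Nat.count_monotone p (not_lt.mp h)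
    omega
  have down : ∀ j : Fin n, ¬ p j → w j ≤ j := by
    intro j hj
    have hc := count_eq_count_of_monotone (fun i => ¬ p i) (fun i => ¬ q i)
      (fun j => not_congr (hV j)) m2 hj
    by_contra h
    have h1 := had.wordHeight_nonneg (w j).2.le
    rw [hheight] at h1
    change (0 : ℤ) ≤ Nat.count p (w j) - Nat.count q (w j) at h1
    have h2 : Nat.count (fun i => ¬ p i) (j.val + 1) ≤ Nat.count (fun i => ¬ p i) (w j) :=
      Nat.count_monotone _ (Fin.lt_def.mp (not_le.mp h))
    rw [Nat.count_succ, if_pos hj] at h2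
    have h3 := count_add_count_not p (w j)
    have h4 := count_add_count_not q (w j)
    omega
  have hp : ∀ j : Fin n, j < w j ↔ p j :=
    fun j => ⟨fun h => by_contra fun h' => (down j h').not_gt h, up j⟩
  refine ⟨w, avoidsDecreasing_of_strictMonoOn w (fun j => p j) m1 m2, fun i hi => ?_⟩
  have h1 := permWord_val w ⟨i, hi⟩
  rw [show permWord w i = _ from h1]
  refine Prod.ext ?_ ?_
  · have := hp ⟨i, hi⟩
    simp only [this]
    simp [p]
  · have h2 := hp (w.symm ⟨i, hi⟩)
    rw [← hV, Equiv.apply_symm_apply] at h2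
    simp only [h2]
    simp [q]

theorem avoiderCount_eq_stateCount (n : ℕ) : avoiderCount n = stateCount n WordState.zero := by
  rw [avoiderCount, stateCount, ← Set.ncard_coe_finset]
  refine Set.ncard_congr (fun w _ => prefixList (permWord w) n) ?_ ?_ ?_
  · intro w hw
    rw [mem_avoiders_iff] at hw
    simp only [Finset.coe_filter, Set.mem_ofPred_eq, mem_wordsOfLength, length_prefixList,
      runWord_eq_zero_iff, true_and]
    refine ⟨hw.2, ?_⟩
    rw [wordHeight_permWord w n le_rfl, Finset.card_eq_zero.mpr]
    · rfl
    · refine Finset.eq_empty_of_forall_notMem fun j hj => ?_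
      rw [mem_crossUp] at hj
      omega
  · intro w w' hw hw' h
    rw [mem_avoiders_iff] at hw hw'
    rw [prefixList_eq_iff] at h
    exact eq_of_permWord_eq hw.1 hw'.1 fun i => h i i.2
  · intro l hl
    simp only [Finset.coe_filter, Set.mem_ofPred_eq, mem_wordsOfLength] at hl
    obtain ⟨rfl, hl⟩ := hl
    obtain ⟨a, ha⟩ := exists_prefixList_eq l
    rw [← ha, runWord_eq_zero_iff] at hl
    obtain ⟨w, hw, hwa⟩ := exists_perm_of_admissibleUpTo a hl.1 hl.2
    have hpre : prefixList (permWord w) l.length = l := by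
      conv_rhs => rw [← ha]
      exact (prefixList_eq_iff _ _ _).mpr hwa
    refine ⟨w, ?_, hpre⟩
    rw [mem_avoiders_iff]
    refine ⟨hw, ?_⟩
    have h2 := (runWord_eq_zero_iff (permWord w) l.length).mp (by
      rw [hpre, ← ha, runWord_eq_zero_iff]
      exact hl)
    exact h2.1

end Bijection

/-! ### Interpolation at the roots of the characteristic polynomial -/

/-- If `r 0, …, r 4` are distinct roots of the characteristic polynomial `f`, every choice of five
initial values is `∑ j, C j * r j ^ k`, and `C j * f' (r j)` is the pairing of the initial values with
the coefficients of `f / (x - r j)`. -/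
theorem exists_coefficients (r : Fin 5 → ℂ) (hr : Function.Injective r)
    (hroot : ∀ j, r j ^ 5 - 4 * r j ^ 4 + 4 * r j ^ 3 - 3 * r j ^ 2 - r j + 1 = 0)
    (a : Fin 5 → ℂ) :
    ∃ C : Fin 5 → ℂ, (∀ k : Fin 5, ∑ j, C j * r j ^ k.val = a k) ∧
      ∀ j, C j * (5 * r j ^ 4 - 16 * r j ^ 3 + 12 * r j ^ 2 - 6 * r j - 1) =
        a 4 + (r j - 4) * a 3 + (r j ^ 2 - 4 * r j + 4) * a 2
          + (r j ^ 3 - 4 * r j ^ 2 + 4 * r j - 3) * a 1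
          + (r j ^ 4 - 4 * r j ^ 3 + 4 * r j ^ 2 - 3 * r j - 1) * a 0 := by
  have hdet : IsUnit (Matrix.vandermonde r).det :=
    isUnit_iff_ne_zero.mpr (Matrix.det_vandermonde_ne_zero_iff.mpr hr)
  have hC : Matrix.vecMul (Matrix.vecMul a (Matrix.vandermonde r)⁻¹) (Matrix.vandermonde r) = a := by
    rw [Matrix.vecMul_vecMul, Matrix.nonsing_inv_mul _ hdet, Matrix.vecMul_one]
  set C := Matrix.vecMul a (Matrix.vandermonde r)⁻¹
  have hk : ∀ k : Fin 5, ∑ j, C j * r j ^ k.val = a k := fun k => congrFun hC k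
  refine ⟨C, hk, fun j => ?_⟩
  set s := r j with hs
  have hq : ∀ i, i ≠ j → r i ^ 4 + (s - 4) * r i ^ 3 + (s ^ 2 - 4 * s + 4) * r i ^ 2
      + (s ^ 3 - 4 * s ^ 2 + 4 * s - 3) * r i + (s ^ 4 - 4 * s ^ 3 + 4 * s ^ 2 - 3 * s - 1) = 0 := by
    intro i hi
    have hne : r i - s ≠ 0 := sub_ne_zero.mpr fun h => hi (hr h)
    refine (mul_eq_zero.mp ?_).resolve_left hne
    linear_combination hroot i - hroot j
  have hsum : ∑ i, C i * (r i ^ 4 + (s - 4) * r i ^ 3 + (s ^ 2 - 4 * s + 4) * r i ^ 2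
      + (s ^ 3 - 4 * s ^ 2 + 4 * s - 3) * r i + (s ^ 4 - 4 * s ^ 3 + 4 * s ^ 2 - 3 * s - 1))
      = C j * (5 * s ^ 4 - 16 * s ^ 3 + 12 * s ^ 2 - 6 * s - 1) := by
    rw [Finset.sum_eq_single j (fun i _ hi => by rw [hq i hi, mul_zero]) (by simp)]
    rw [← hs]
    ring
  rw [← hsum, ← hk 4, ← hk 3, ← hk 2, ← hk 1, ← hk 0]
  simp only [Fin.sum_univ_five, Fin.val_zero, Fin.val_one, Fin.val_two,
    show ((3 : Fin 5) : ℕ) = 3 from rfl, show ((4 : Fin 5) : ℕ) = 4 from rfl]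
  ring

/-- At a root of the characteristic polynomial its derivative does not vanish, as soon as there are
five distinct roots. -/
theorem deriv_ne_zero_of_roots (r : Fin 5 → ℂ) (hr : Function.Injective r)
    (hroot : ∀ j, r j ^ 5 - 4 * r j ^ 4 + 4 * r j ^ 3 - 3 * r j ^ 2 - r j + 1 = 0) (j : Fin 5) :
    5 * r j ^ 4 - 16 * r j ^ 3 + 12 * r j ^ 2 - 6 * r j - 1 ≠ 0 := by
  -- Interpolate the initial values `0, 0, 0, 0, 1`.
  obtain ⟨C, -, hC⟩ := exists_coefficients r hr hroot ![0, 0, 0, 0, 1]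
  intro h
  have := hC j
  rw [h] at this
  simp at this

/-- A solution of the recurrence with initial values `1, 1, 2, 5, 14` as a combination of powers. -/
theorem closed_form_of_recurrence (u : ℕ → ℂ) (r C : Fin 5 → ℂ)
    (hroot : ∀ j, r j ^ 5 - 4 * r j ^ 4 + 4 * r j ^ 3 - 3 * r j ^ 2 - r j + 1 = 0)
    (hinit : ∀ k : Fin 5, u k = ∑ j, C j * r j ^ k.val)
    (hrec : ∀ n, u (n + 5) = 4 * u (n + 4) - 4 * u (n + 3) + 3 * u (n + 2) + u (n + 1) - u n)
    (n : ℕ) : u n = ∑ j, C j * r j ^ n := by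
  induction n using Nat.strong_induction_on with
  | _ n ih =>
    rcases Nat.lt_or_ge n 5 with hn | hn
    · exact hinit ⟨n, hn⟩
    · obtain ⟨m, rfl⟩ := Nat.exists_eq_add_of_le' hn
      rw [hrec, ih (m + 4) (by omega), ih (m + 3) (by omega), ih (m + 2) (by omega),
        ih (m + 1) (by omega), ih m (by omega)]
      simp only [Finset.mul_sum, ← Finset.sum_add_distrib, ← Finset.sum_sub_distrib]
      refine Finset.sum_congr rfl fun j _ => ?_
      linear_combination (-(C j * r j ^ m)) * hroot j

/-! ### The real roots and their coefficients -/

/-- The value of the characteristic polynomial at a real number. -/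
def quinticEval (x : ℝ) : ℝ := x ^ 5 - 4 * x ^ 4 + 4 * x ^ 3 - 3 * x ^ 2 - x + 1

theorem exists_root_of_sign_change {a b : ℝ} (hab : a ≤ b)
    (h : quinticEval a ≤ 0 ∧ 0 ≤ quinticEval b ∨ quinticEval b ≤ 0 ∧ 0 ≤ quinticEval a) :
    ∃ x, a ≤ x ∧ x ≤ b ∧ quinticEval x = 0 := by
  have hc : ContinuousOn quinticEval (Set.Icc a b) := by
    unfold quinticEval
    fun_prop
  rcases h with h | h
  · obtain ⟨x, hx, hx0⟩ := intermediate_value_Icc hab hc h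
    exact ⟨x, hx.1, hx.2, hx0⟩
  · obtain ⟨x, hx, hx0⟩ := intermediate_value_Icc' hab hc h
    exact ⟨x, hx.1, hx.2, hx0⟩

theorem abs_pow_le_of_abs_le {e δ : ℝ} (he : |e| ≤ δ) (hδ : δ ≤ 1) (k : ℕ) :
    -δ ≤ e ^ (k + 1) ∧ e ^ (k + 1) ≤ δ := by
  rw [← abs_le, abs_pow, pow_succ]
  have h1 : |e| ^ k ≤ 1 := pow_le_one₀ (abs_nonneg e) (he.trans hδ)
  calc |e| ^ k * |e| ≤ 1 * |e| := mul_le_mul_of_nonneg_right h1 (abs_nonneg e)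
    _ ≤ δ := by rwa [one_mul]

theorem abs_div_sub_le {g p c d ε : ℝ} (hd : 0 < d) (hp : d ≤ |p|)
    (h : |g - c * p| ≤ ε * d) : |g / p - c| ≤ ε := by
  have hp0 : p ≠ 0 := abs_pos.mp (hd.trans_le hp)
  have hε : 0 ≤ ε := by
    by_contra h'
    have := (abs_nonneg _).trans h
    nlinarith
  rw [show g / p - c = (g - c * p) / p by field_simp, abs_div, div_le_iff₀ (abs_pos.mpr hp0)]
  exact h.trans (mul_le_mul_of_nonneg_left hp hε)

theorem abs_mul_sub_mul_le {x y a b δ ε : ℝ} (hx : |x - a| ≤ δ) (hy : |y - b| ≤ ε) :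
    |x * y - a * b| ≤ |a| * ε + |b| * δ + δ * ε := by
  have h : x * y - a * b = a * (y - b) + b * (x - a) + (x - a) * (y - b) := by ring
  rw [h]
  refine (abs_add_three _ _ _).trans ?_
  rw [abs_mul, abs_mul, abs_mul]
  gcongr
  exact (abs_nonneg _).trans hx

theorem roundsTo_of_abs_sub_le {x x₀ a δ : ℝ} (hx : |x - x₀| ≤ δ)
    (h : |x₀ - a| + δ < 1 / 2 * (1 / 10) ^ 5) : RoundsTo x a :=
  lt_of_le_of_lt (abs_sub_le x x₀ a) (by linarith)

/-- The coefficient of `r ^ n` in the expansion of the solution with initial values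
`1, 1, 2, 5, 14`: the pairing of these values with `f / (x - r)`, divided by `f' r`. -/
noncomputable def rootCoeff (r : ℝ) : ℝ :=
  (r ^ 4 - 3 * r ^ 3 + 2 * r ^ 2 - 2 * r - 2) /
    (5 * r ^ 4 - 16 * r ^ 3 + 12 * r ^ 2 - 6 * r - 1)

theorem exists_real_roots :
    ∃ R₁ R₂ R₃ : ℝ, quinticEval R₁ = 0 ∧ quinticEval R₂ = 0 ∧ quinticEval R₃ = 0 ∧
      |R₁ - (-0.4956852841)| ≤ 1 / 10 ^ 10 ∧ |R₂ - 0.5115403181| ≤ 1 / 10 ^ 10 ∧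
      |R₃ - 3.0308965087| ≤ 1 / 10 ^ 10 := by
  obtain ⟨R₁, h1, h1', h1r⟩ := exists_root_of_sign_change
    (show (-0.4956852842 : ℝ) ≤ -0.4956852840 by norm_num)
    (Or.inl (by unfold quinticEval; norm_num))
  obtain ⟨R₂, h2, h2', h2r⟩ := exists_root_of_sign_change
    (show (0.5115403180 : ℝ) ≤ 0.5115403182 by norm_num)
    (Or.inr (by unfold quinticEval; norm_num))
  obtain ⟨R₃, h3, h3', h3r⟩ := exists_root_of_sign_change
    (show (3.0308965086 : ℝ) ≤ 3.0308965088 by norm_num)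
    (Or.inl (by unfold quinticEval; norm_num))
  refine ⟨R₁, R₂, R₃, h1r, h2r, h3r, ?_, ?_, ?_⟩ <;> rw [abs_le] <;> constructor <;> norm_num <;>
    linarith

/-- The coefficient at the negative root. Numerator and denominator are expanded at the decimal
approximation of the root, so that only powers of the error `e` have to be bounded. -/
theorem abs_rootCoeff_sub_le₁ {R : ℝ} (h : |R - (-0.4956852841)| ≤ 1 / 10 ^ 10) :
    |rootCoeff R - (-0.0127526538)| ≤ 1 / 10 ^ 8 := by
  obtain ⟨e, rfl⟩ : ∃ e, R = -0.4956852841 + e := ⟨R + 0.4956852841, by ring⟩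
  rw [add_sub_cancel_left] at h
  have p := abs_pow_le_of_abs_le h (by norm_num)
  have p0 := p 0
  have p1 := p 1
  have p2 := p 2
  have p3 := p 3
  simp only [Nat.reduceAdd, zero_add, pow_one] at p0 p1 p2 p3
  refine abs_div_sub_le (d := 7) (by norm_num) (le_abs.mpr (Or.inl ?_)) (abs_le.mpr ⟨?_, ?_⟩) <;>
    norm_num1 at p0 p1 p2 p3 ⊢ <;> ring_nf <;> linarith

theorem abs_rootCoeff_sub_le₂ {R : ℝ} (h : |R - 0.5115403181| ≤ 1 / 10 ^ 10) :
    |rootCoeff R - 1.0382373906| ≤ 1 / 10 ^ 8 := by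
  obtain ⟨e, rfl⟩ : ∃ e, R = 0.5115403181 + e := ⟨R - 0.5115403181, by ring⟩
  rw [add_sub_cancel_left] at h
  have p := abs_pow_le_of_abs_le h (by norm_num)
  have p0 := p 0
  have p1 := p 1
  have p2 := p 2
  have p3 := p 3
  simp only [Nat.reduceAdd, zero_add, pow_one] at p0 p1 p2 p3
  refine abs_div_sub_le (d := 2) (by norm_num) (le_abs.mpr (Or.inr ?_)) (abs_le.mpr ⟨?_, ?_⟩) <;>
    norm_num1 at p0 p1 p2 p3 ⊢ <;> ring_nf <;> linarith

theorem abs_rootCoeff_sub_le₃ {R : ℝ} (h : |R - 3.0308965087| ≤ 1 / 10 ^ 10) :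
    |rootCoeff R - 0.1654759461| ≤ 1 / 10 ^ 8 := by
  obtain ⟨e, rfl⟩ : ∃ e, R = 3.0308965087 + e := ⟨R - 3.0308965087, by ring⟩
  rw [add_sub_cancel_left] at h
  have p := abs_pow_le_of_abs_le h (by norm_num)
  have p0 := p 0
  have p1 := p 1
  have p2 := p 2
  have p3 := p 3
  simp only [Nat.reduceAdd, zero_add, pow_one] at p0 p1 p2 p3
  refine abs_div_sub_le (d := 60) (by norm_num) (le_abs.mpr (Or.inl ?_)) (abs_le.mpr ⟨?_, ?_⟩) <;>
    norm_num1 at p0 p1 p2 p3 ⊢ <;> ring_nf <;> linarith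

/-- Dividing the characteristic polynomial by the cubic with three of its roots leaves no remainder:
the remainder has degree at most two and three zeros. -/
theorem quotient_relations {x y z : ℝ} (hx : quinticEval x = 0) (hy : quinticEval y = 0)
    (hz : quinticEval z = 0) (hxy : x ≠ y) (hxz : x ≠ z) (hyz : y ≠ z) :
    ∃ b c : ℝ, b = x + y + z - 4 ∧
      c = 4 - (x * y + x * z + y * z) + (x + y + z) * b ∧
      -(x * y * z) + (x * y + x * z + y * z) * b - (x + y + z) * c = -3 ∧
      -(x * y * z) * b + (x * y + x * z + y * z) * c = -1 ∧ -(x * y * z) * c = 1 := by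
  refine ⟨_, _, rfl, rfl, ?_⟩
  set b := x + y + z - 4 with hb
  set c := 4 - (x * y + x * z + y * z) + (x + y + z) * b with hc
  unfold quinticEval at hx hy hz
  obtain ⟨r₂, hr₂⟩ : ∃ r, r = -3 - (-(x * y * z) + (x * y + x * z + y * z) * b
    - (x + y + z) * c) := ⟨_, rfl⟩
  obtain ⟨r₁, hr₁⟩ : ∃ r, r = -1 - (-(x * y * z) * b + (x * y + x * z + y * z) * c) := ⟨_, rfl⟩
  obtain ⟨r₀, hr₀⟩ : ∃ r, r = 1 - -(x * y * z) * c := ⟨_, rfl⟩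
  have ex : r₂ * x ^ 2 + r₁ * x + r₀ = 0 := by
    rw [hr₂, hr₁, hr₀, hc, hb]
    linear_combination hx
  have ey : r₂ * y ^ 2 + r₁ * y + r₀ = 0 := by
    rw [hr₂, hr₁, hr₀, hc, hb]
    linear_combination hy
  have ez : r₂ * z ^ 2 + r₁ * z + r₀ = 0 := by
    rw [hr₂, hr₁, hr₀, hc, hb]
    linear_combination hz
  have exy : r₂ * (x + y) + r₁ = 0 :=
    (mul_eq_zero.mp (show (x - y) * _ = 0 by linear_combination ex - ey)).resolve_left
      (sub_ne_zero.mpr hxy)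
  have exz : r₂ * (x + z) + r₁ = 0 :=
    (mul_eq_zero.mp (show (x - z) * _ = 0 by linear_combination ex - ez)).resolve_left
      (sub_ne_zero.mpr hxz)
  have e2 : r₂ = 0 :=
    (mul_eq_zero.mp (show (y - z) * r₂ = 0 by linear_combination exy - exz)).resolve_left
      (sub_ne_zero.mpr hyz)
  have e1 : r₁ = 0 := by linear_combination exy - (x + y) * e2
  have e0 : r₀ = 0 := by linear_combination ex - x ^ 2 * e2 - x * e1
  refine ⟨?_, ?_, ?_⟩ <;> linarith

/-! ### The non-real roots and the closed form -/

open ComplexConjugate in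
/-- The non-real roots are those of the quadratic cofactor `x² + b x + c` of the real roots; here
`x₄` is their real part and `-y₄` the imaginary part of the one in the lower half plane. -/
theorem exists_root_system :
    ∃ R₁ R₂ R₃ x₄ y₄ : ℝ, |R₁ - (-0.4956852841)| ≤ 1 / 10 ^ 10 ∧
      |R₂ - 0.5115403181| ≤ 1 / 10 ^ 10 ∧ |R₃ - 3.0308965087| ≤ 1 / 10 ^ 10 ∧
      |x₄ - 0.4766242286| ≤ 1 / 10 ^ 8 ∧ |y₄ - 1.0363523424| ≤ 1 / 10 ^ 8 ∧
      ∀ z : ℂ, z ^ 5 - 4 * z ^ 4 + 4 * z ^ 3 - 3 * z ^ 2 - z + 1 =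
        (z - R₁) * (z - R₂) * (z - R₃) * (z - ⟨x₄, -y₄⟩) * (z - conj ⟨x₄, -y₄⟩) := by
  obtain ⟨R₁, R₂, R₃, r1, r2, r3, b1, b2, b3⟩ := exists_real_roots
  have b12 := abs_mul_sub_mul_le b1 b2
  have b13 := abs_mul_sub_mul_le b1 b3
  have b23 := abs_mul_sub_mul_le b2 b3
  have a1 := abs_le.mp b1
  have a2 := abs_le.mp b2
  have a3 := abs_le.mp b3
  norm_num [abs_of_pos, abs_of_neg] at b12 b13 b23
  have a12 := abs_le.mp b12
  have a13 := abs_le.mp b13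
  have a23 := abs_le.mp b23
  obtain ⟨b, c, hb, hc, e1, e2, e3⟩ := quotient_relations r1 r2 r3
    (by intro h; rw [h] at a1; norm_num at a1 a2; linarith)
    (by intro h; rw [h] at a1; norm_num at a1 a3; linarith)
    (by intro h; rw [h] at a2; norm_num at a2 a3; linarith)
  -- The coefficients of the quadratic follow to nine digits from the three real roots.
  have hbb : |b - (-0.9532484573)| ≤ 3 / 10 ^ 10 := by
    rw [abs_le]
    norm_num at a1 a2 a3 ⊢
    constructor <;> linarith
  have hb2 := abs_mul_sub_mul_le hbb hbb
  have hS : |(R₁ + R₂ + R₃) - 3.0467515427| ≤ 3 / 10 ^ 10 := by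
    rw [abs_le]
    norm_num at a1 a2 a3 ⊢
    constructor <;> linarith
  have hSb := abs_mul_sub_mul_le hS hbb
  norm_num [abs_of_pos, abs_of_neg] at hb2 hSb
  have ab2 := abs_le.mp hb2
  have aSb := abs_le.mp hSb
  have hD : |(c - b ^ 2 / 4) - 1.0740261776| ≤ 1 / 10 ^ 8 := by
    rw [abs_le, hc]
    norm_num at ab2 aSb a12 a13 a23 ⊢
    constructor <;> linarith
  have aD := abs_le.mp hD
  norm_num at aD
  have hDpos : 0 ≤ c - b ^ 2 / 4 := by linarith
  set y := Real.sqrt (c - b ^ 2 / 4) with hy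
  have hy2 : y ^ 2 = c - b ^ 2 / 4 := Real.sq_sqrt hDpos
  have hyb : |y - 1.0363523424| ≤ 1 / 10 ^ 8 := by
    rw [abs_le]
    constructor
    · have : (1.0363523324 : ℝ) ≤ y := Real.le_sqrt_of_sq_le (by norm_num; linarith)
      norm_num at this ⊢
      linarith
    · have : y ≤ 1.0363523524 := by
        rw [hy, Real.sqrt_le_left (by norm_num)]
        norm_num
        linarith
      norm_num at this ⊢
      linarith
  refine ⟨R₁, R₂, R₃, -b / 2, y, b1, b2, b3, ?_, hyb, ?_⟩
  · have := abs_le.mp hbb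
    rw [abs_le]
    norm_num at this ⊢
    constructor <;> linarith
  · intro z
    have hquad : (z - (⟨-b / 2, -y⟩ : ℂ)) * (z - conj (⟨-b / 2, -y⟩ : ℂ)) = z ^ 2 + b * z + c := by
      have h1 : (⟨-b / 2, -y⟩ : ℂ) = -b / 2 - y * Complex.I := by
        apply Complex.ext <;> simp
      have h2 : conj (⟨-b / 2, -y⟩ : ℂ) = -b / 2 + y * Complex.I := by
        apply Complex.ext <;> simp
      have h3 : (y : ℂ) ^ 2 = c - b ^ 2 / 4 := by exact_mod_cast hy2
      rw [h2, h1]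
      linear_combination h3 - (y : ℂ) ^ 2 * Complex.I_sq
    have hb' : (b : ℂ) = R₁ + R₂ + R₃ - 4 := by exact_mod_cast hb
    have hc' : (c : ℂ) = 4 - (R₁ * R₂ + R₁ * R₃ + R₂ * R₃) + (R₁ + R₂ + R₃) * b := by
      exact_mod_cast hc
    have e1' : -((R₁ : ℂ) * R₂ * R₃) + (R₁ * R₂ + R₁ * R₃ + R₂ * R₃) * b
      - (R₁ + R₂ + R₃) * c = -3 := by exact_mod_cast e1
    have e2' : -((R₁ : ℂ) * R₂ * R₃) * b + (R₁ * R₂ + R₁ * R₃ + R₂ * R₃) * c = -1 := by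
      exact_mod_cast e2
    have e3' : -((R₁ : ℂ) * R₂ * R₃) * c = 1 := by exact_mod_cast e3
    rw [mul_assoc _ (z - _) (z - conj _), hquad]
    linear_combination -z ^ 4 * hb' - z ^ 3 * hc' - z ^ 2 * e1' - z * e2' - e3'

/-- The relations for `n = 0` and `n = 1`, with the real coefficients known, determine the
coefficient of a non-real root. -/
theorem abs_sub_le_of_relations {α β x y s t : ℝ} (hx : |x - 0.4766242286| ≤ 1 / 10 ^ 8)
    (hy : |y - 1.0363523424| ≤ 1 / 10 ^ 8) (hs : |s - 1.1909606829| ≤ 3 / 10 ^ 8)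
    (ht : |t - 1.0389620552| ≤ 3 / 10 ^ 7) (h0 : s + 2 * α = 1)
    (h1 : t + 2 * (α * x + β * y) = 1) :
    |α - (-0.0954803414)| ≤ 1 / 10 ^ 6 / 5 ∧ |β - 0.0251142545| ≤ 1 / 10 ^ 6 / 5 ∧
      |(α * x + β * y) - (-0.0194810276)| ≤ 1 / 10 ^ 6 / 5 ∧
      |(-(α * y) + β * x) - 0.1109213377| ≤ 1 / 10 ^ 6 := by
  have hα : |α - (-0.0954803414)| ≤ 2 / 10 ^ 8 := by
    have := abs_le.mp hs
    rw [abs_le]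
    norm_num at this ⊢
    constructor <;> linarith
  have hτ : |(α * x + β * y) - (-0.0194810276)| ≤ 1 / 10 ^ 6 / 6 := by
    have := abs_le.mp ht
    rw [abs_le]
    norm_num at this ⊢
    constructor <;> linarith
  have hαx := abs_mul_sub_mul_le hα hx
  have hαy := abs_mul_sub_mul_le hα hy
  norm_num [abs_of_pos, abs_of_neg] at hαx hαy
  have ay := abs_le.mp hy
  have aαx := abs_le.mp hαx
  have aτ := abs_le.mp hτ
  norm_num at ay
  have hy1 : 1 ≤ |y| := le_abs.mpr (Or.inl (by linarith))
  have hβ : |β - 0.0251142545| ≤ 1 / 10 ^ 6 / 5 := by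
    have hy0 : y ≠ 0 := abs_pos.mp (by linarith)
    have h := abs_div_sub_le (g := β * y) (c := 0.0251142545) (ε := 1 / 10 ^ 6 / 5)
      one_pos hy1 (by
        rw [abs_le]
        norm_num at aτ aαx ⊢
        constructor <;> linarith)
    rwa [mul_div_cancel_right₀ _ hy0] at h
  have hβx := abs_mul_sub_mul_le hβ hx
  norm_num [abs_of_pos, abs_of_neg] at hβx
  refine ⟨hα.trans (by norm_num), hβ, hτ.trans (by norm_num), ?_⟩
  have aαy := abs_le.mp hαy
  have aβx := abs_le.mp hβx
  rw [abs_le]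
  norm_num at aαy aβx ⊢
  constructor <;> linarith

theorem avoiderCount_recurrence (n : ℕ) :
    (avoiderCount (n + 5) : ℤ) = 4 * avoiderCount (n + 4) - 4 * avoiderCount (n + 3)
      + 3 * avoiderCount (n + 2) + avoiderCount (n + 1) - avoiderCount n := by
  simp only [avoiderCount_eq_stateCount]
  exact stateCount_zero_recurrence n

theorem roots_charQuintic_of_factorization (r : Fin 5 → ℂ)
    (h : ∀ z : ℂ, z ^ 5 - 4 * z ^ 4 + 4 * z ^ 3 - 3 * z ^ 2 - z + 1 =
      (z - r 0) * (z - r 1) * (z - r 2) * (z - r 3) * (z - r 4)) :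
    charQuintic.roots = {r 0, r 1, r 2, r 3, r 4} := by
  have hp : charQuintic = (Multiset.map (fun a => Polynomial.X - Polynomial.C a)
      {r 0, r 1, r 2, r 3, r 4}).prod := by
    refine Polynomial.funext fun z => ?_
    simp only [charQuintic, Multiset.insert_eq_cons, Multiset.map_cons, Multiset.map_singleton,
      Multiset.prod_cons, Multiset.prod_singleton, Polynomial.eval_mul, Polynomial.eval_sub,
      Polynomial.eval_X, Polynomial.eval_C, Polynomial.eval_add, Polynomial.eval_pow,
      Polynomial.eval_one, Polynomial.eval_ofNat]
    rw [h z]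
    ring
  rw [hp, Polynomial.roots_multiset_prod_X_sub_C]

open ComplexConjugate in
theorem exists_closed_form {R₁ R₂ R₃ : ℝ} {R₄ : ℂ} (h12 : R₁ ≠ R₂) (h13 : R₁ ≠ R₃)
    (h23 : R₂ ≠ R₃) (h4 : R₄.im ≠ 0)
    (hf : ∀ z : ℂ, z ^ 5 - 4 * z ^ 4 + 4 * z ^ 3 - 3 * z ^ 2 - z + 1 =
      (z - R₁) * (z - R₂) * (z - R₃) * (z - R₄) * (z - conj R₄)) :
    ∃ c₄ : ℂ, ∀ n : ℕ, (avoiderCount n : ℂ) =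
      rootCoeff R₁ * R₁ ^ n + rootCoeff R₂ * R₂ ^ n + rootCoeff R₃ * R₃ ^ n + c₄ * R₄ ^ n
        + conj (c₄ * R₄ ^ n) := by
  set r : Fin 5 → ℂ := ![R₁, R₂, R₃, R₄, conj R₄] with hr
  have hreal : ∀ x : ℝ, (x : ℂ) ≠ R₄ ∧ (x : ℂ) ≠ conj R₄ := by
    intro x
    constructor <;> intro h <;> have := congrArg Complex.im h <;> simp at this
    · exact h4 this.symm
    · exact h4 this
  have hconj : R₄ ≠ conj R₄ := fun h => h4 (Complex.conj_eq_iff_im.mp h.symm)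
  have hinj : Function.Injective r := by
    have c12 : (R₁ : ℂ) ≠ R₂ := by exact_mod_cast h12
    have c13 : (R₁ : ℂ) ≠ R₃ := by exact_mod_cast h13
    have c23 : (R₂ : ℂ) ≠ R₃ := by exact_mod_cast h23
    intro i j hij
    fin_cases i <;> fin_cases j <;> first
      | rfl
      | exact absurd hij c12
      | exact absurd hij.symm c12
      | exact absurd hij c13
      | exact absurd hij.symm c13
      | exact absurd hij c23
      | exact absurd hij.symm c23
      | exact absurd hij hconj
      | exact absurd hij.symm hconj
      | exact absurd hij (hreal _).1
      | exact absurd hij.symm (hreal _).1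
      | exact absurd hij (hreal _).2
      | exact absurd hij.symm (hreal _).2
  have hroot : ∀ j, r j ^ 5 - 4 * r j ^ 4 + 4 * r j ^ 3 - 3 * r j ^ 2 - r j + 1 = 0 := by
    intro j
    rw [hf]
    fin_cases j <;> simp [hr]
  have hne := deriv_ne_zero_of_roots r hinj hroot
  obtain ⟨C, hC, hC'⟩ := exists_coefficients r hinj hroot ![1, 1, 2, 5, 14]
  have hG : ∀ j, C j * (5 * r j ^ 4 - 16 * r j ^ 3 + 12 * r j ^ 2 - 6 * r j - 1)
      = r j ^ 4 - 3 * r j ^ 3 + 2 * r j ^ 2 - 2 * r j - 2 := by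
    intro j
    rw [hC' j]
    simp
    ring
  have hCr : ∀ (j : Fin 5) (x : ℝ), r j = x → C j = rootCoeff x := by
    intro j x hx
    have h1 := hG j
    have h2 := hne j
    rw [hx] at h1 h2
    rw [eq_div_of_mul_eq h2 h1, rootCoeff]
    push_cast
    rfl
  have hC4 : C 4 = conj (C 3) := by
    have h3 := congrArg conj (hG 3)
    have h4 := hG 4
    have h5 := hne 4
    have e4 : r 4 = conj (r 3) := rfl
    simp only [map_mul, map_sub, map_add, map_pow, map_ofNat, map_one, ← e4] at h3
    exact mul_right_cancel₀ h5 (h4.trans h3.symm)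
  have hcf := closed_form_of_recurrence (fun n => (avoiderCount n : ℂ)) r C hroot
    (by
      intro k
      rw [hC k, avoiderCount_eq_stateCount]
      obtain ⟨i0, i1, i2, i3, i4⟩ := stateCount_zero_initial
      fin_cases k <;> simp [i0, i1, i2, i3, i4])
    (fun n => by exact_mod_cast avoiderCount_recurrence n)
  refine ⟨C 3, fun n => (hcf n).trans ?_⟩
  rw [Fin.sum_univ_five, hCr 0 R₁ rfl, hCr 1 R₂ rfl, hCr 2 R₃ rfl, hC4]
  simp [hr]

theorem mainTheorem3 :
    (∀ n : ℕ, 4 ≤ n →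
      (avoiderCount (n + 1) : ℤ) =
        4 * avoiderCount n - 4 * avoiderCount (n - 1) + 3 * avoiderCount (n - 2)
          + avoiderCount (n - 3) - avoiderCount (n - 4)) ∧
    ∃ (R₁ R₂ R₃ c₁ c₂ c₃ : ℝ) (R₄ c₄ : ℂ),
      charQuintic.roots =
        {(R₁ : ℂ), (R₂ : ℂ), (R₃ : ℂ), R₄, (starRingEnd ℂ) R₄} ∧
      (∀ n : ℕ, (avoiderCount n : ℂ) =
        c₁ * R₁ ^ n + c₂ * R₂ ^ n + c₃ * R₃ ^ n + c₄ * R₄ ^ n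
          + (starRingEnd ℂ) (c₄ * R₄ ^ n)) ∧
      RoundsTo R₁ (-0.49569) ∧ RoundsTo R₂ 0.51154 ∧ RoundsTo R₃ 3.03090 ∧
      RoundsToComplex R₄ 0.47662 (-1.03635) ∧
      RoundsTo c₁ (-0.01275) ∧ RoundsTo c₂ 1.03824 ∧ RoundsTo c₃ 0.16548 ∧
      RoundsToComplex c₄ (-0.09548) 0.02511 ∧
      RoundsTo (c₁ * R₁) 0.00632 ∧ RoundsTo (c₂ * R₂) 0.53110 ∧
      RoundsTo (c₃ * R₃) 0.50154 ∧ RoundsToComplex (c₄ * R₄) (-0.01948) 0.11092 := by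
  refine ⟨fun n hn => ?_, ?_⟩
  · obtain ⟨m, rfl⟩ := Nat.exists_eq_add_of_le' hn
    exact avoiderCount_recurrence m
  obtain ⟨R₁, R₂, R₃, x, y, b1, b2, b3, bx, hyb, hf⟩ := exists_root_system
  have a1 := abs_le.mp b1
  have a2 := abs_le.mp b2
  have a3 := abs_le.mp b3
  have ay := abs_le.mp hyb
  norm_num at a1 a2 a3 ay
  obtain ⟨c₄, hc₄⟩ := exists_closed_form (R₄ := ⟨x, -y⟩) (by intro h; linarith)
    (by intro h; linarith) (by intro h; linarith)
    (by
      intro h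
      have : -y = 0 := h
      linarith) hf
  have k1 := abs_rootCoeff_sub_le₁ b1
  have k2 := abs_rootCoeff_sub_le₂ b2
  have k3 := abs_rootCoeff_sub_le₃ b3
  have m1 := abs_mul_sub_mul_le k1 b1
  have m2 := abs_mul_sub_mul_le k2 b2
  have m3 := abs_mul_sub_mul_le k3 b3
  set c₁ := rootCoeff R₁
  set c₂ := rootCoeff R₂
  set c₃ := rootCoeff R₃
  obtain ⟨i0, i1, -⟩ := stateCount_zero_initial
  have n0 := hc₄ 0
  have n1 := hc₄ 1
  rw [avoiderCount_eq_stateCount, i0] at n0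
  rw [avoiderCount_eq_stateCount, i1] at n1
  have hs : |(c₁ + c₂ + c₃) - 1.1909606829| ≤ 3 / 10 ^ 8 := by
    have h1 := abs_le.mp k1
    have h2 := abs_le.mp k2
    have h3 := abs_le.mp k3
    rw [abs_le]
    norm_num at h1 h2 h3 ⊢
    constructor <;> linarith
  have ht : |(c₁ * R₁ + c₂ * R₂ + c₃ * R₃) - 1.0389620552| ≤ 3 / 10 ^ 7 := by
    have h1 := abs_le.mp m1
    have h2 := abs_le.mp m2
    have h3 := abs_le.mp m3
    rw [abs_le]
    norm_num [abs_of_pos, abs_of_neg] at h1 h2 h3 ⊢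
    constructor <;> linarith
  obtain ⟨p1, p2, p3, p4⟩ := abs_sub_le_of_relations (α := c₄.re) (β := c₄.im) bx hyb hs ht
    (by
      have := congrArg Complex.re n0
      simp at this
      linarith)
    (by
      have := congrArg Complex.re n1
      simp at this
      linarith)
  refine ⟨R₁, R₂, R₃, c₁, c₂, c₃, ⟨x, -y⟩, c₄, ?_, hc₄, ?_, ?_, ?_, ⟨?_, ?_⟩, ?_, ?_, ?_, ⟨?_, ?_⟩,
    ?_, ?_, ?_, ⟨?_, ?_⟩⟩
  · exact roots_charQuintic_of_factorization ![R₁, R₂, R₃, ⟨x, -y⟩, (starRingEnd ℂ) ⟨x, -y⟩] hf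
  · exact roundsTo_of_abs_sub_le b1 (by norm_num [abs_of_pos, abs_of_neg])
  · exact roundsTo_of_abs_sub_le b2 (by norm_num [abs_of_pos, abs_of_neg])
  · exact roundsTo_of_abs_sub_le b3 (by norm_num [abs_of_pos, abs_of_neg])
  · exact roundsTo_of_abs_sub_le bx (by norm_num [abs_of_pos, abs_of_neg])
  · refine roundsTo_of_abs_sub_le (x₀ := -1.0363523424) (δ := 1 / 10 ^ 8) ?_
      (by norm_num [abs_of_pos, abs_of_neg])
    rw [← abs_neg]
    convert hyb using 2
    ring
  · exact roundsTo_of_abs_sub_le k1 (by norm_num [abs_of_pos, abs_of_neg])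
  · exact roundsTo_of_abs_sub_le k2 (by norm_num [abs_of_pos, abs_of_neg])
  · exact roundsTo_of_abs_sub_le k3 (by norm_num [abs_of_pos, abs_of_neg])
  · exact roundsTo_of_abs_sub_le p1 (by norm_num [abs_of_pos, abs_of_neg])
  · exact roundsTo_of_abs_sub_le p2 (by norm_num [abs_of_pos, abs_of_neg])
  · exact roundsTo_of_abs_sub_le m1 (by norm_num [abs_of_pos, abs_of_neg])
  · exact roundsTo_of_abs_sub_le m2 (by norm_num [abs_of_pos, abs_of_neg])
  · exact roundsTo_of_abs_sub_le m3 (by norm_num [abs_of_pos, abs_of_neg])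
  · refine roundsTo_of_abs_sub_le ?_ (x₀ := -0.0194810276) (δ := 1 / 10 ^ 6 / 5)
      (by norm_num [abs_of_pos, abs_of_neg])
    convert p3 using 2
    simp
  · refine roundsTo_of_abs_sub_le ?_ (x₀ := 0.1109213377) (δ := 1 / 10 ^ 6)
      (by norm_num [abs_of_pos, abs_of_neg])
    convert p4 using 2
    simp
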